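/- Let $m\ge 1$ and $\alpha\in(0,1)$ be fixed. A data-generating process (DGP) $\mathbf P$ for sample size $n$ is the joint law of $n$ identically distributed, arbitrarily dependent random vectors $X_1,\dots,X_n\in\mathbb R^m$ with finite mean $\mu_0(\mathbf P)=\mathbf E_{\mathbf P}[X_1]$; write $\mu_{0k}(\mathbf P)$ and $X_{i,k}$ for $k$-th components. Let $\bar X=n^{-1}\sum_{i=1}^n X_i$ and $\hat{\boldsymbol\Sigma}=n^{-1}\sum_{i=1}^n (X_i-\bar X)(X_i-\bar X)'$. Let $R_n\ge 2$ be integers and let $\pi=(\pi_r)_{r=1}^{R_n}$ be i.i.d. uniform draws from the permutations of $\{1,\dots,n\}$, independent of the data $\boldsymbol X=(X_1,\dots,X_n)$. Put $$T_{U,k}(a;\pi)=\frac{1}{\sqrt{mR_n}}\sum_{r=1}^{R_n}(X_{\pi_r(1),k}-a)\,\hat{\boldsymbol\Sigma}_{kk}^{-1}\,(X_{\pi_r(2),k}-a),$$ $$\hat\lambda_k=\bar X_k\hat{\boldsymbol\Sigma}_{kk}^{-1}\frac{1}{\sqrt{mR_n}}\sum_{r=1}^{R_n}\left(X_{\pi_r(1),k}+X_{\pi_r(2),k}\right)-\sqrt{\frac{R_n}{m}}\,\hat{\boldsymbol\Sigma}_{kk}^{-1}\bar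 X_k^2,$$ $$Q_n(\pi)=\max_{1\le k\le m}\left\{T_{U,k}(0;\pi)-\hat\lambda_k\mathbf 1\{\bar X_k<0\}\right\},\qquad \tilde Q_n(\pi)=\max_{1\le k\le m}T_{U,k}(\bar X_k;\pi),$$ where $\hat{\boldsymbol\Sigma}_{kk}^{-1}=1/\hat{\boldsymbol\Sigma}_{kk}$. Let $c_{1-\alpha}$ be the $(1-\alpha)$-quantile of the conditional distribution of $\tilde Q_n(\pi)$ given $\boldsymbol X$, and let $\phi_n=\mathbf 1\{Q_n(\pi)>c_{1-\alpha}\}$. Let $\mathcal P_0$ be a class of DGPs for which there are constants $\delta,L,U\in(0,\infty)$ such that every sequence $\{\mathbf P_n\}_{n\in\mathbb N}\subseteq\mathcal P_0$ (with $\mathbf P_n$ governing the sample of size $n$) satisfies: - $n^{-1/2}\sum_{i=1}^n(X_i-\mu_0(\mathbf P_n))=O_{\mathbf P_n}(1)$; - there is a matrix $\boldsymbol\Sigma$ with $\hat{\boldsymbol\Sigma}\stackrel{p}{\longrightarrow}\boldsymbol\Sigma$, $\max_{i,j}|\boldsymbol\Sigma_{ij}|<U$ and smallest eigenvalue $\lambda_{\min}(\boldsymbol\Sigma)>L$;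 - $n^{-1}\sum_{i=1}^n\|X_i\|^{2+\delta}=O_{\mathbf P_n}(1)$, where $\|\cdot\|$ is the sup norm. Let $\{\mathbf P_n\}_{n\in\mathbb N}\subseteq\mathcal P_0$ be such that, for every $k$, the limit $\delta_k^*=\lim_{n\to\infty}R_n^{1/4}\mu_{0k}(\mathbf P_n)\in\mathbb R\cup\{-\infty,\infty\}$ exists. Suppose $R_n\to\infty$ and $\sqrt{R_n}/n\to 0$. Then: (a) if $\max_k\delta_k^*\le 0$, then $\mathbf E_{\mathbf P_n}[\phi_n]\to\alpha$; (b) if $\max_k\delta_k^*=\infty$, then $\mathbf E_{\mathbf P_n}[\phi_n]\to 1$; (c) if $\max_k\delta_k^*\in(0,\infty)$, then $\mathbf E_{\mathbf P_n}[\phi_n]\to\beta$ for some $\beta>\alpha$. -/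

import Mathlib

open MeasureTheory ProbabilityTheory Filter Topology
open scoped ENNReal

noncomputable section

namespace ResampledTest

/-! ### Data and sample moments -/

/-- A sample of `n` observations in `ℝ^m`; `x i k` is the `k`-th component of the `i`-th observation.
The norm of `Fin m → ℝ` is the sup norm. -/
abbrev Sample (n m : ℕ) : Type := Fin n → Fin m → ℝ

/-- A data-generating process for samples of size `n`: the joint law of `n` identically distributed,
arbitrarily dependent, random vectors with a finite mean. -/
structure DGP (n m : ℕ) where
  /-- the joint law of the observations -/
  law : Measure (Sample n m)
  isProbabilityMeasure : IsProbabilityMeasure law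
  identDistrib : ∀ i j : Fin n, IdentDistrib (fun x : Sample n m => x i) (fun x => x j) law law
  integrable : ∀ i : Fin n, Integrable (fun x : Sample n m => x i) law

attribute [instance] DGP.isProbabilityMeasure

/-- The population mean `μ₀(P) = E_P[X₁]`, component by component
(`0` for the empty sample, which has no first observation). -/
def DGP.mean {n m : ℕ} (P : DGP n m) : Fin m → ℝ :=
  fun k => if h : 0 < n then ∫ x, x ⟨0, h⟩ k ∂P.law else 0

/-- The sample mean. -/
def sampleMean {n m : ℕ} (x : Sample n m) : Fin m → ℝ :=
  fun k => (n : ℝ)⁻¹ * ∑ i, x i k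

/-- The sample variance matrix `n⁻¹ ∑ᵢ (Xᵢ - X̄)(Xᵢ - X̄)'`. -/
def sampleVar {n m : ℕ} (x : Sample n m) : Matrix (Fin m) (Fin m) ℝ :=
  Matrix.of fun k l => (n : ℝ)⁻¹ * ∑ i, (x i k - sampleMean x k) * (x i l - sampleMean x l)

/-! ### Resampling draws -/

instance permMeasurableSpace (n : ℕ) : MeasurableSpace (Equiv.Perm (Fin n)) := ⊤

instance permDiscrete (n : ℕ) : DiscreteMeasurableSpace (Equiv.Perm (Fin n)) :=
  ⟨fun _ => trivial⟩

/-- `R` permutations of the `n` observation indices. -/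
abbrev Draws (n R : ℕ) : Type := Fin R → Equiv.Perm (Fin n)

/-- The law of `R` i.i.d. uniform draws from the permutations of the observation indices. -/
def drawLaw (n R : ℕ) : Measure (Draws n R) :=
  Measure.pi fun _ => (PMF.uniformOfFintype (Equiv.Perm (Fin n))).toMeasure

/-- The observation `X_{σ(j+1)}` (indices are counted from `0` here, so `j = 0` and `j = 1` give
`X_{σ(1)}` and `X_{σ(2)}`); the value `0` is used only if the sample has at most `j` observations. -/
def drawn {n m : ℕ} (x : Sample n m) (σ : Equiv.Perm (Fin n)) (j : ℕ) : Fin m → ℝ :=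
  if h : j < n then x (σ ⟨j, h⟩) else 0

/-! ### The moment inequality test -/

/-- The U-type statistic of the `k`-th component, centred at `a`, with normalization `(m R)^{-1/2}`. -/
def uStat {n m R : ℕ} (x : Sample n m) (π : Draws n R) (k : Fin m) (a : ℝ) : ℝ :=
  (Real.sqrt (m * R))⁻¹ *
    ∑ r, (drawn x (π r) 0 k - a) * (sampleVar x k k)⁻¹ * (drawn x (π r) 1 k - a)

/-- The statistic `λ̂ₖ`. -/
def lambdaHat {n m R : ℕ} (x : Sample n m) (π : Draws n R) (k : Fin m) : ℝ :=
  sampleMean x k * (sampleVar x k k)⁻¹ * (Real.sqrt (m * R))⁻¹ *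
      ∑ r, (drawn x (π r) 0 k + drawn x (π r) 1 k)
    - Real.sqrt (R / m) * (sampleVar x k k)⁻¹ * sampleMean x k ^ 2

/-- The test statistic `Qₙ(π) = maxₖ (T_{U,k}(0; π) - λ̂ₖ 1{X̄ₖ < 0})`. -/
def testStat {n m R : ℕ} (x : Sample n m) (π : Draws n R) : ℝ :=
  ⨆ k : Fin m, (uStat x π k 0 - lambdaHat x π k * (if sampleMean x k < 0 then 1 else 0))

/-- The recentred statistic `Q̃ₙ(π) = maxₖ T_{U,k}(X̄ₖ; π)`. -/
def centredStat {n m R : ℕ} (x : Sample n m) (π : Draws n R) : ℝ :=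
  ⨆ k : Fin m, uStat x π k (sampleMean x k)

/-- The critical value: the `(1 - α)`-quantile of the law of `Q̃ₙ(π)` when the data are held fixed
and only the permutations are random. -/
def critVal {n m : ℕ} (R : ℕ) (α : ℝ) (x : Sample n m) : ℝ :=
  sInf {c : ℝ | 1 - α ≤ (drawLaw n R).real {π | centredStat x π ≤ c}}

/-- The test `φₙ`: `1` if the null is rejected and `0` if it is not. -/
def test {n m R : ℕ} (α : ℝ) (x : Sample n m) (π : Draws n R) : ℝ :=
  if critVal R α x < testStat x π then 1 else 0

/-- The rejection probability `E_P[φₙ]`, the permutations being independent of the data. -/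
def rejectionProb {n m : ℕ} (P : DGP n m) (R : ℕ) (α : ℝ) : ℝ :=
  ∫ ω : Sample n m × Draws n R, test α ω.1 ω.2 ∂(P.law.prod (drawLaw n R))

/-! ### Stochastic order and the regularity conditions -/

/-- `Sₙ = O_{Pₙ}(1)`: boundedness in probability along a sequence of probability spaces. -/
def BoundedInProb {Ω : ℕ → Type*} [∀ n, MeasurableSpace (Ω n)] {E : Type*} [Norm E]
    (μ : ∀ n, Measure (Ω n)) (S : ∀ n, Ω n → E) : Prop :=
  ∀ ε : ℝ, 0 < ε → ∃ M : ℝ, ∀ᶠ n in atTop, (μ n).real {ω | M < ‖S n ω‖} ≤ ε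

/-- Convergence in probability of real random variables to a constant, along a sequence of
probability spaces. -/
def ConvergesInProb {Ω : ℕ → Type*} [∀ n, MeasurableSpace (Ω n)]
    (μ : ∀ n, Measure (Ω n)) (S : ∀ n, Ω n → ℝ) (c : ℝ) : Prop :=
  ∀ ε : ℝ, 0 < ε → Tendsto (fun n => (μ n).real {ω | ε ≤ |S n ω - c|}) atTop (𝓝 0)

/-- The regularity conditions on a sequence of data-generating processes, for given constants:
`√n`-consistency of the sample mean; convergence in probability of the sample variance to a matrix
whose entries are bounded by `U` and whose eigenvalues exceed `L`; and a stochastically bounded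
empirical moment of order `2 + δ`. -/
structure RegularSequence {m : ℕ} (δ L U : ℝ) (P : ∀ n, DGP n m) : Prop where
  rootN : BoundedInProb (fun n => (P n).law)
    (fun n x => fun k => (Real.sqrt n)⁻¹ * ∑ i, (x i k - (P n).mean k))
  variance : ∃ S : Matrix (Fin m) (Fin m) ℝ,
    (∀ k l, ConvergesInProb (fun n => (P n).law) (fun _ x => sampleVar x k l) (S k l)) ∧
    (∀ k l, |S k l| < U) ∧
    ∃ hS : S.IsHermitian, ∀ k, L < hS.eigenvalues k
  moment : BoundedInProb (fun n => (P n).law)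
    (fun n x => (n : ℝ)⁻¹ * ∑ i, ‖x i‖ ^ (2 + δ))

/-- A class of data-generating processes, given by the processes it allows at each sample size, is
regular if, for some positive constants, every sequence in it satisfies the regularity conditions. -/
def RegularClass {m : ℕ} (𝒟 : ∀ n, Set (DGP n m)) : Prop :=
  ∃ δ L U : ℝ, 0 < δ ∧ 0 < L ∧ 0 < U ∧
    ∀ P : ∀ n, DGP n m, (∀ n, P n ∈ 𝒟 n) → RegularSequence δ L U P

end ResampledTest

end

open ResampledTest

/-!
Hold the data fixed. The vector of recentred statistics is then a normalized sum of `R` i.i.d.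
terms, one for each permutation. Sampling without replacement gives every term a mean of order
`1 / n`, which `√R / n → 0` makes negligible, and covariances tending to
`Sₖₗ² / (m Sₖₖ Sₗₗ)`. This matrix is positive definite by Schur's product theorem, so the Lyapunov
central limit theorem yields a nondegenerate Gaussian limit, and the critical value converges to the
point `q` on the diagonal at which the limiting distribution function `F` is `1 - α`.

The test statistic differs from the recentred one by a shift which, when scaled means
`R^{1/4} X̄ₖ` converge, tends to `sₖ = m^{-1/2} Sₖₖ⁻¹ max(δₖ*, 0)²`; the part of the shift that is
linear in the data vanishes by Chebyshev's inequality. Rejection therefore has limiting probability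
`1 - F(q - s)`, which is `α` if `s = 0`, exceeds `α` if `s` is finite and nonzero because `F` is
strictly increasing, and is replaced by `1` if some shift diverges.

Convergence in probability is convergence along the filter of events whose probability tends to `1`.
Hence the random data can be replaced by arbitrary sequences of fixed samples which satisfy the
regularity conditions exactly, and bounded convergence returns to the unconditional probability.
-/

noncomputable section

namespace ResampledTest

section Permutations

open scoped BigOperators

variable {ι : Type*} [Fintype ι] [DecidableEq ι]

lemma integral_uniformOfFintype {Ω : Type*} [Fintype Ω] [Nonempty Ω] [MeasurableSpace Ω]
    [MeasurableSingletonClass Ω] (f : Ω → ℝ) :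
    ∫ ω, f ω ∂(PMF.uniformOfFintype Ω).toMeasure = 𝔼 ω, f ω := by
  simp [PMF.integral_eq_sum, Fintype.expect_eq_sum_div_card, div_eq_inv_mul, Finset.mul_sum]

lemma expect_perm_apply_pair_eq {a b c d : ι} (hab : a ≠ b) (hcd : c ≠ d) (f : ι → ι → ℝ) :
    𝔼 σ : Equiv.Perm ι, f (σ c) (σ d) = 𝔼 σ : Equiv.Perm ι, f (σ a) (σ b) := by
  obtain ⟨τ, hτa, hτb⟩ :=
    MulAction.is_two_pretransitive_iff.1 (Equiv.Perm.isMultiplyPretransitive ι 2) hab hcd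
  refine Fintype.expect_equiv (Equiv.mulRight τ) _ _ fun σ => ?_
  rw [← hτa, ← hτb]
  rfl

lemma expect_perm_apply_pair {a b : ι} (hab : a ≠ b) (f : ι → ι → ℝ) :
    𝔼 σ : Equiv.Perm ι, f (σ a) (σ b) = 𝔼 p ∈ Finset.univ.offDiag, f p.1 p.2 := by
  have offDiag_nonempty : (Finset.univ.offDiag : Finset (ι × ι)).Nonempty := ⟨(a, b), by simpa⟩
  calc 𝔼 σ : Equiv.Perm ι, f (σ a) (σ b)
      = 𝔼 _p ∈ (Finset.univ.offDiag : Finset (ι × ι)), 𝔼 σ : Equiv.Perm ι, f (σ a) (σ b) :=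
        (Finset.expect_const offDiag_nonempty _).symm
    _ = 𝔼 p ∈ Finset.univ.offDiag, 𝔼 σ : Equiv.Perm ι, f (σ p.1) (σ p.2) :=
        Finset.expect_congr rfl fun p hp =>
          (expect_perm_apply_pair_eq hab (Finset.mem_offDiag.1 hp).2.2 f).symm
    _ = 𝔼 σ : Equiv.Perm ι, 𝔼 p ∈ Finset.univ.offDiag, f (σ p.1) (σ p.2) :=
        Finset.expect_comm _ _ _
    _ = 𝔼 _σ : Equiv.Perm ι, 𝔼 p ∈ Finset.univ.offDiag, f p.1 p.2 :=
        Finset.expect_congr rfl fun σ _ =>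
          Finset.expect_equiv (Equiv.prodCongr σ σ) (by simp) (fun _ _ => rfl)
    _ = 𝔼 p ∈ Finset.univ.offDiag, f p.1 p.2 := Fintype.expect_const _

/-- The uniform law on the permutations of the observation indices. -/
def permLaw (n : ℕ) : Measure (Equiv.Perm (Fin n)) :=
  (PMF.uniformOfFintype (Equiv.Perm (Fin n))).toMeasure

instance (n : ℕ) : IsProbabilityMeasure (permLaw n) := by unfold permLaw; infer_instance

instance (n R : ℕ) : IsProbabilityMeasure (drawLaw n R) := by unfold drawLaw; infer_instance

lemma drawLaw_eq_pi_permLaw (n R : ℕ) : drawLaw n R = Measure.pi fun _ => permLaw n := rfl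

lemma integral_permLaw_apply_pair {n : ℕ} {a b : Fin n} (hab : a ≠ b) (f : Fin n → Fin n → ℝ) :
    (n : ℝ) * (n - 1) * ∫ σ, f (σ a) (σ b) ∂permLaw n = ∑ i, ∑ j, f i j - ∑ i, f i i := by
  have card_offDiag : ((Finset.univ.offDiag : Finset (Fin n × Fin n)).card : ℝ) = n * (n - 1) := by
    rw [Finset.offDiag_card, Nat.cast_sub (Nat.le_mul_self _)]
    simp [mul_sub]
  have sum_offDiag :
      ∑ i, f i i + ∑ p ∈ Finset.univ.offDiag, f p.1 p.2 = ∑ i, ∑ j, f i j := by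
    rw [← Fintype.sum_prod_type', ← Finset.univ_product_univ,
      ← Finset.diag_union_offDiag, Finset.sum_union (Finset.disjoint_diag_offDiag _),
      Finset.sum_diag]
  rw [permLaw, integral_uniformOfFintype, expect_perm_apply_pair hab, ← card_offDiag,
    Finset.card_mul_expect, ← sum_offDiag, add_sub_cancel_left]

end Permutations

section CentredObservations

variable {n m : ℕ}

/-- The observations centred at the sample mean. -/
def centred (x : Sample n m) : Sample n m := fun i k => x i k - sampleMean x k

lemma mul_sampleMean (x : Sample n m) (k : Fin m) : n * sampleMean x k = ∑ i, x i k := by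
  rcases n.eq_zero_or_pos with rfl | hn
  · simp
  · rw [sampleMean, mul_inv_cancel_left₀ (by positivity)]

lemma sum_centred (x : Sample n m) (k : Fin m) : ∑ i, centred x i k = 0 := by
  simp [centred, Finset.sum_sub_distrib, mul_sampleMean]

lemma sum_centred_mul (x : Sample n m) (k l : Fin m) :
    ∑ i, centred x i k * centred x i l = n * sampleVar x k l := by
  rcases n.eq_zero_or_pos with rfl | hn
  · simp
  · rw [sampleVar, Matrix.of_apply, mul_inv_cancel_left₀ (by positivity)]
    rfl

lemma sampleVar_self_nonneg (x : Sample n m) (k : Fin m) : 0 ≤ sampleVar x k k :=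
  mul_nonneg (by positivity) (Finset.sum_nonneg fun _ _ => mul_self_nonneg _)

lemma drawn_sub_sampleMean {j : ℕ} (hj : j < n) (x : Sample n m) (σ : Equiv.Perm (Fin n))
    (k : Fin m) : drawn x σ j k - sampleMean x k = centred x (σ ⟨j, hj⟩) k := by
  simp [drawn, centred, hj]

/-- The summand of `uStat` at the sample mean, as a function of one permutation. -/
def pairTerm (x : Sample n m) (σ : Equiv.Perm (Fin n)) (k : Fin m) : ℝ :=
  (drawn x σ 0 k - sampleMean x k) * (sampleVar x k k)⁻¹ * (drawn x σ 1 k - sampleMean x k)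

lemma uStat_sampleMean {R : ℕ} (x : Sample n m) (π : Draws n R) (k : Fin m) :
    uStat x π k (sampleMean x k) = (√(m * R))⁻¹ * ∑ r, pairTerm x (π r) k := rfl

lemma pairTerm_eq (hn : 2 ≤ n) (x : Sample n m) (σ : Equiv.Perm (Fin n)) (k : Fin m) :
    pairTerm x σ k = centred x (σ ⟨0, by lia⟩) k * (sampleVar x k k)⁻¹ *
      centred x (σ ⟨1, by lia⟩) k := by
  rw [pairTerm, drawn_sub_sampleMean, drawn_sub_sampleMean]

lemma integral_pairTerm (hn : 2 ≤ n) (x : Sample n m) (k : Fin m) :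
    ((n : ℝ) - 1) * ∫ σ, pairTerm x σ k ∂permLaw n = -(sampleVar x k k * (sampleVar x k k)⁻¹) := by
  have hn_ne : (n : ℝ) ≠ 0 := by positivity
  have sum_pairs : ∑ i, ∑ j, centred x i k * (sampleVar x k k)⁻¹ * centred x j k = 0 := by
    simp [← Finset.mul_sum, sum_centred]
  have sum_diag : ∑ i, centred x i k * (sampleVar x k k)⁻¹ * centred x i k
      = n * (sampleVar x k k * (sampleVar x k k)⁻¹) := by
    rw [← mul_assoc, ← sum_centred_mul, Finset.sum_mul]
    exact Finset.sum_congr rfl fun i _ => mul_right_comm _ _ _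
  simp only [pairTerm_eq hn]
  refine mul_left_cancel₀ hn_ne ?_
  rw [← mul_assoc, integral_permLaw_apply_pair (by simp)
    (fun i j => centred x i k * (sampleVar x k k)⁻¹ * centred x j k), sum_pairs, sum_diag]
  ring

lemma integral_pairTerm_mul (hn : 2 ≤ n) (x : Sample n m) (k l : Fin m) :
    (n : ℝ) * (n - 1) * ∫ σ, pairTerm x σ k * pairTerm x σ l ∂permLaw n =
      (sampleVar x k k)⁻¹ * (sampleVar x l l)⁻¹ *
        ((n * sampleVar x k l) ^ 2 - ∑ i, (centred x i k * centred x i l) ^ 2) := by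
  simp only [pairTerm_eq hn]
  rw [integral_permLaw_apply_pair (by simp) (fun i j =>
    (centred x i k * (sampleVar x k k)⁻¹ * centred x j k) *
      (centred x i l * (sampleVar x l l)⁻¹ * centred x j l)), mul_sub, ← sum_centred_mul, sq,
    Finset.sum_mul_sum]
  simp only [Finset.mul_sum]
  congr 1
  · exact Finset.sum_congr rfl fun i _ => Finset.sum_congr rfl fun j _ => by ring
  · exact Finset.sum_congr rfl fun i _ => by ring

lemma integral_mul_apply_pair_le {a b : Fin n} (hab : a ≠ b) (g : Fin n → ℝ) :
    ∫ σ, g (σ a) * g (σ b) ∂permLaw n ≤ 2 * ((n : ℝ)⁻¹ * ∑ i, g i) ^ 2 := by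
  have hn : (2 : ℝ) ≤ n := by
    have := Fintype.one_lt_card_iff.2 ⟨a, b, hab⟩
    rw [Fintype.card_fin] at this
    exact_mod_cast this
  have pairs_pos : 0 < (n : ℝ) * (n - 1) := mul_pos (by linarith) (by linarith)
  refine le_of_mul_le_mul_left ?_ pairs_pos
  calc (n : ℝ) * (n - 1) * ∫ σ, g (σ a) * g (σ b) ∂permLaw n
      = (∑ i, g i) * (∑ i, g i) - ∑ i, g i * g i := by
        rw [integral_permLaw_apply_pair hab (fun i j => g i * g j), ← Finset.sum_mul_sum]
    _ ≤ (∑ i, g i) * (∑ i, g i) :=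
        sub_le_self _ (Finset.sum_nonneg fun i _ => mul_self_nonneg (g i))
    _ ≤ 2 * (n - 1) / n * ((∑ i, g i) * (∑ i, g i)) := by
        refine le_mul_of_one_le_left (mul_self_nonneg _) ?_
        rw [one_le_div (by linarith)]
        linarith
    _ = n * (n - 1) * (2 * ((n : ℝ)⁻¹ * ∑ i, g i) ^ 2) := by field_simp

/-- The sum of the two observations drawn by one permutation, each centred at the sample mean. -/
def sumTerm (x : Sample n m) (σ : Equiv.Perm (Fin n)) (k : Fin m) : ℝ :=
  drawn x σ 0 k + drawn x σ 1 k - 2 * sampleMean x k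

lemma sumTerm_eq (hn : 2 ≤ n) (x : Sample n m) (σ : Equiv.Perm (Fin n)) (k : Fin m) :
    sumTerm x σ k = centred x (σ ⟨0, by lia⟩) k + centred x (σ ⟨1, by lia⟩) k := by
  rw [← drawn_sub_sampleMean, ← drawn_sub_sampleMean, sumTerm]
  ring

lemma integral_sumTerm (hn : 2 ≤ n) (x : Sample n m) (k : Fin m) :
    ∫ σ, sumTerm x σ k ∂permLaw n = 0 := by
  have hn' : (2 : ℝ) ≤ n := by exact_mod_cast hn
  have pairs_ne : (n : ℝ) * (n - 1) ≠ 0 := mul_ne_zero (by linarith) (by linarith)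
  simp only [sumTerm_eq hn]
  refine (mul_eq_zero_iff_left pairs_ne).1 ?_
  rw [integral_permLaw_apply_pair (by simp) (fun i j => centred x i k + centred x j k)]
  simp [Finset.sum_add_distrib, ← Finset.mul_sum, sum_centred]

lemma integral_sumTerm_sq_le (hn : 2 ≤ n) (x : Sample n m) (k : Fin m) :
    ∫ σ, sumTerm x σ k ^ 2 ∂permLaw n ≤ 4 * sampleVar x k k := by
  have hn' : (2 : ℝ) ≤ n := by exact_mod_cast hn
  have pairs_pos : 0 < (n : ℝ) * (n - 1) := mul_pos (by linarith) (by linarith)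
  have sum_sq : ∑ i, centred x i k ^ 2 = n * sampleVar x k k := by
    simp only [← sum_centred_mul, sq]
  have sum_pairs :
      ∑ i, ∑ j, (centred x i k + centred x j k) ^ 2 = 2 * n * (n * sampleVar x k k) := by
    simp only [add_sq, Finset.sum_add_distrib, ← Finset.mul_sum, sum_centred, sum_sq,
      mul_zero, Finset.sum_const_zero, Finset.sum_const, Finset.card_univ, Fintype.card_fin,
      nsmul_eq_mul]
    ring
  have sum_diag : ∑ i, (centred x i k + centred x i k) ^ 2 = 4 * (n * sampleVar x k k) := by
    rw [← sum_sq, Finset.mul_sum]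
    exact Finset.sum_congr rfl fun i _ => by ring
  simp only [sumTerm_eq hn]
  refine le_of_mul_le_mul_left ?_ pairs_pos
  rw [integral_permLaw_apply_pair (by simp) (fun i j => (centred x i k + centred x j k) ^ 2),
    sum_pairs, sum_diag]
  linarith [mul_nonneg (mul_self_nonneg (n : ℝ)) (sampleVar_self_nonneg x k)]

end CentredObservations

section CentralLimitTheorem

open Asymptotics

lemma tendsto_one_add_pow_exp {α : Type*} {l : Filter α} {r : α → ℕ} {g : α → ℂ} {t : ℂ}
    (hr : Tendsto r l atTop) (hg : Tendsto (fun a => r a * g a) l (𝓝 t)) :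
    Tendsto (fun a => (1 + g a) ^ r a) l (𝓝 (Complex.exp t)) := by
  have g_tendsto : Tendsto g l (𝓝 0) := by
    have := (tendsto_inv_atTop_nhds_zero_nat (𝕜 := ℂ)).comp hr |>.mul hg
    rw [zero_mul] at this
    refine this.congr' ?_
    filter_upwards [hr.eventually_ne_atTop 0] with a ha
    exact inv_mul_cancel_left₀ (Nat.cast_ne_zero.2 ha) _
  have log_sub_tendsto : Tendsto (fun a => r a * (Complex.log (1 + g a) - g a)) l (𝓝 0) := by
    refine ((isBigO_refl (fun a => (r a : ℂ)) l).mul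
      (Complex.log_sub_self_isBigO.comp_tendsto g_tendsto)).trans_tendsto ?_
    simpa only [mul_zero, sq, Function.comp_def, mul_assoc] using hg.mul g_tendsto
  have log_tendsto : Tendsto (fun a => r a * Complex.log (1 + g a)) l (𝓝 t) := by
    simpa only [← mul_add, add_sub_cancel, add_zero] using hg.add log_sub_tendsto
  refine ((Complex.continuous_exp.tendsto t).comp log_tendsto).congr' ?_
  filter_upwards [g_tendsto.eventually_ne (neg_ne_zero.2 one_ne_zero).symm] with a ha
  rw [Function.comp_apply, Complex.exp_nat_mul, Complex.exp_log]
  rwa [Ne, add_comm, add_eq_zero_iff_eq_neg]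

lemma norm_exp_mul_I_sub_taylor_le {δ : ℝ} (hδ : 0 ≤ δ) (hδ1 : δ ≤ 1) (u : ℝ) :
    ‖Complex.exp (u * Complex.I) - (1 + u * Complex.I - u ^ 2 / 2)‖ ≤ 4 * |u| ^ (2 + δ) := by
  have norm_mul_I : ‖(u : ℂ) * Complex.I‖ = |u| := by simp
  rcases le_or_gt |u| 1 with hu | hu
  · have taylor : ∑ k ∈ Finset.range 3, (u * Complex.I) ^ k / (k.factorial : ℂ)
        = 1 + u * Complex.I - u ^ 2 / 2 := by
      simp only [Finset.sum_range_succ, Finset.sum_range_zero, mul_pow, Complex.I_sq]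
      norm_num [Nat.factorial]
      ring
    calc _ ≤ |u| ^ 3 * (((3 : ℕ).succ : ℝ) * (((3 : ℕ).factorial : ℝ) * (3 : ℕ))⁻¹) := by
          rw [← taylor, ← norm_mul_I]
          exact Complex.exp_bound (norm_mul_I.trans_le hu) (by norm_num)
      _ ≤ |u| ^ 3 * 4 := by
          gcongr
          norm_num [Nat.factorial]
      _ ≤ 4 * |u| ^ (2 + δ) := by
          rw [mul_comm, ← Real.rpow_natCast]
          gcongr 4 * ?_
          refine Real.rpow_le_rpow_of_exponent_ge' (abs_nonneg u) hu (by linarith) ?_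
          push_cast
          linarith
  · have sq_le : |u| ^ 2 ≤ |u| ^ (2 + δ) := by
      rw [← Real.rpow_two]
      exact Real.rpow_le_rpow_of_exponent_le hu.le (by linarith)
    calc _ ≤ ‖Complex.exp (u * Complex.I)‖
          + (‖(1 : ℂ)‖ + ‖(u : ℂ) * Complex.I‖ + ‖(u : ℂ) ^ 2 / 2‖) :=
          (norm_sub_le _ _).trans (add_le_add_right
            ((norm_sub_le _ _).trans (add_le_add_left (norm_add_le _ _) _)) _)
      _ = 1 + (1 + |u| + |u| ^ 2 / 2) := by
          rw [Complex.norm_exp_ofReal_mul_I, norm_mul_I]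
          simp
      _ ≤ 4 * |u| ^ (2 + δ) := by nlinarith

lemma norm_charFun_sub_taylor_le {δ : ℝ} (hδ : 0 ≤ δ) (hδ1 : δ ≤ 1) {ν : Measure ℝ}
    [IsProbabilityMeasure ν] (hν : MemLp id (ENNReal.ofReal (2 + δ)) ν) (t : ℝ) :
    ‖charFun ν t - (1 + (t * ∫ x, x ∂ν : ℝ) * Complex.I - ((t ^ 2 * ∫ x, x ^ 2 ∂ν : ℝ) : ℂ) / 2)‖
      ≤ 4 * (|t| ^ (2 + δ) * ∫ x, |x| ^ (2 + δ) ∂ν) := by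
  have memLp_two : MemLp id 2 ν :=
    hν.mono_exponent (by rw [← ENNReal.ofReal_ofNat]; exact ENNReal.ofReal_le_ofReal (by linarith))
  have integrable_id : Integrable (fun x : ℝ => x) ν := memLp_two.integrable one_le_two
  have integrable_sq : Integrable (fun x : ℝ => x ^ 2) ν := memLp_two.integrable_sq
  have integrable_rpow : Integrable (fun x : ℝ => |x| ^ (2 + δ)) ν := by
    have := hν.integrable_norm_rpow (by simp; linarith) ENNReal.ofReal_ne_top
    rwa [ENNReal.toReal_ofReal (by linarith)] at this
  have integrable_exp : Integrable (fun x : ℝ => Complex.exp ((t * x : ℝ) * Complex.I)) ν :=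
    .of_bound (by fun_prop) 1 (.of_forall fun x => (Complex.norm_exp_ofReal_mul_I _).le)
  have integrable_linear : Integrable (fun x : ℝ => 1 + ((t * x : ℝ) : ℂ) * Complex.I) ν :=
    (integrable_const _).add ((integrable_id.const_mul t).ofReal.mul_const _)
  have integrable_quadratic : Integrable (fun x : ℝ => ((t * x : ℝ) : ℂ) ^ 2 / 2) ν := by
    simp only [← Complex.ofReal_pow, mul_pow]
    exact (integrable_sq.const_mul (t ^ 2)).ofReal.div_const 2
  have integral_taylor :
      (1 + (t * ∫ x, x ∂ν : ℝ) * Complex.I - ((t ^ 2 * ∫ x, x ^ 2 ∂ν : ℝ) : ℂ) / 2)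
        = ∫ x : ℝ, (1 + ((t * x : ℝ) : ℂ) * Complex.I - ((t * x : ℝ) : ℂ) ^ 2 / 2) ∂ν := by
    rw [← integral_const_mul, ← integral_const_mul,
      integral_sub integrable_linear integrable_quadratic,
      integral_add (integrable_const _) ((integrable_id.const_mul t).ofReal.mul_const _),
      integral_mul_const, integral_div]
    simp only [← Complex.ofReal_pow, mul_pow, integral_complex_ofReal, integral_const,
      probReal_univ, one_smul]
  simp only [charFun_apply_real, ← Complex.ofReal_mul]
  rw [integral_taylor, ← integral_sub integrable_exp
    (g := fun x : ℝ => 1 + ((t * x : ℝ) : ℂ) * Complex.I - ((t * x : ℝ) : ℂ) ^ 2 / 2)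
    (integrable_linear.sub integrable_quadratic), ← integral_const_mul, ← integral_const_mul]
  refine norm_integral_le_of_norm_le ((integrable_rpow.const_mul _).const_mul _)
    (.of_forall fun x => ?_)
  refine (norm_exp_mul_I_sub_taylor_le hδ hδ1 (t * x)).trans_eq ?_
  rw [abs_mul, Real.mul_rpow (abs_nonneg _) (abs_nonneg _)]

lemma mul_inv_sqrt_rpow_two_add {r : ℝ} (hr : 0 < r) (δ : ℝ) :
    r * (√r)⁻¹ ^ (2 + δ) = r ^ (-(δ / 2)) := by
  rw [Real.sqrt_eq_rpow, ← Real.rpow_neg hr.le, ← Real.rpow_mul hr.le]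
  nth_rw 1 [← Real.rpow_one r]
  rw [← Real.rpow_add hr]
  congr 1
  ring

lemma tendsto_charFun_inv_sqrt_pow {δ v C : ℝ} (hδ : 0 < δ) (hδ1 : δ ≤ 1) {ν : ℕ → Measure ℝ}
    [∀ j, IsProbabilityMeasure (ν j)] {r : ℕ → ℕ} (hr : Tendsto r atTop atTop)
    (memLp : ∀ j, MemLp id (ENNReal.ofReal (2 + δ)) (ν j))
    (mean : Tendsto (fun j => √(r j) * ∫ x, x ∂ν j) atTop (𝓝 0))
    (second : Tendsto (fun j => ∫ x, x ^ 2 ∂ν j) atTop (𝓝 v))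
    (moment : ∀ᶠ j in atTop, ∫ x, |x| ^ (2 + δ) ∂ν j ≤ C) :
    Tendsto (fun j => charFun (ν j) (√(r j))⁻¹ ^ r j) atTop (𝓝 (Complex.exp (-(v / 2 : ℝ)))) := by
  set taylor : ℕ → ℂ := fun j => 1 + ((√(r j))⁻¹ * ∫ x, x ∂ν j : ℝ) * Complex.I
    - (((√(r j))⁻¹ ^ 2 * ∫ x, x ^ 2 ∂ν j : ℝ) : ℂ) / 2
  have remainder : Tendsto (fun j => r j * (charFun (ν j) (√(r j))⁻¹ - taylor j)) atTop (𝓝 0) := by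
    have bound_tendsto : Tendsto (fun j => 4 * ((r j : ℝ) ^ (-(δ / 2)) * C)) atTop (𝓝 0) := by
      have := (tendsto_rpow_neg_atTop (half_pos hδ)).comp (tendsto_natCast_atTop_atTop.comp hr)
      simpa using (this.mul_const C).const_mul 4
    refine squeeze_zero_norm' ?_ bound_tendsto
    filter_upwards [moment, hr.eventually_gt_atTop 0] with j hj hrj
    have hr_pos : (0 : ℝ) < r j := Nat.cast_pos.2 hrj
    calc ‖r j * (charFun (ν j) (√(r j))⁻¹ - taylor j)‖
        ≤ r j * (4 * (|(√(r j))⁻¹| ^ (2 + δ) * C)) := by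
          rw [norm_mul, Complex.norm_natCast]
          gcongr
          exact (norm_charFun_sub_taylor_le hδ.le hδ1 (memLp j) _).trans (by gcongr)
      _ = 4 * ((r j : ℝ) ^ (-(δ / 2)) * C) := by
          rw [← mul_inv_sqrt_rpow_two_add hr_pos, abs_of_nonneg (by positivity)]
          ring
  have main : Tendsto (fun j => r j * (taylor j - 1)) atTop (𝓝 (-(v / 2 : ℝ))) := by
    have limit := (mean.ofReal.mul_const Complex.I).sub (second.ofReal.div_const (2 : ℂ))
    simp only [Complex.ofReal_zero, zero_mul, zero_sub] at limit
    convert limit.congr' ?_ using 2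
    · push_cast
      rfl
    filter_upwards [hr.eventually_gt_atTop 0] with j hj
    have hr_ne : (√(r j) : ℂ) ≠ 0 := by simpa using hj.ne'
    have hr_sq : (r j : ℂ) = (√(r j) : ℂ) ^ 2 := by
      rw [← Complex.ofReal_pow, Real.sq_sqrt (Nat.cast_nonneg _), Complex.ofReal_natCast]
    simp only [taylor, hr_sq]
    push_cast
    field_simp
    ring
  have := tendsto_one_add_pow_exp hr (g := fun j => charFun (ν j) (√(r j))⁻¹ - 1) <| by
    simpa only [← mul_add, sub_add_sub_cancel, zero_add] using remainder.add main
  simpa only [add_sub_cancel] using this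

variable {ι : Type*} [Fintype ι]

lemma charFun_map_inner {ν : Measure (EuclideanSpace ℝ ι)} (t : EuclideanSpace ℝ ι) (s : ℝ) :
    charFun (ν.map fun y => inner ℝ y t) s = charFun ν (s • t) := by
  rw [charFun_apply_real, charFun_apply, integral_map (by fun_prop) (by fun_prop)]
  simp [inner_smul_right]

/-- The law of `r^{-1/2} ∑ᵢ Yᵢ` for `r` independent random vectors `Yᵢ` of law `ν`. -/
def normalizedSumLaw (ν : ProbabilityMeasure (EuclideanSpace ℝ ι)) (r : ℕ) :
    ProbabilityMeasure (EuclideanSpace ℝ ι) :=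
  ⟨(Measure.pi fun _ : Fin r => (ν : Measure (EuclideanSpace ℝ ι))).map
    fun y => (√r)⁻¹ • ∑ i, y i, Measure.isProbabilityMeasure_map (by fun_prop)⟩

lemma charFun_normalizedSumLaw (ν : ProbabilityMeasure (EuclideanSpace ℝ ι)) (r : ℕ)
    (t : EuclideanSpace ℝ ι) :
    charFun (normalizedSumLaw ν r : Measure (EuclideanSpace ℝ ι)) t =
      charFun (ν : Measure (EuclideanSpace ℝ ι)) ((√r)⁻¹ • t) ^ r := by
  rw [normalizedSumLaw, ProbabilityMeasure.coe_mk, charFun_map_smul_comp (by fun_prop),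
    charFun_map_sum_pi_eq_prod]
  simp

section Inner

variable {ν : Measure (EuclideanSpace ℝ ι)}

lemma integral_inner_eq_sum [IsFiniteMeasure ν] (hν : MemLp id 2 ν) (t : EuclideanSpace ℝ ι) :
    ∫ y, inner ℝ y t ∂ν = ∑ k, t k * ∫ y, y k ∂ν := by
  have integrable_coord (k : ι) : Integrable (fun y : EuclideanSpace ℝ ι => t k * y k) ν :=
    ((hν.eval_piLp k).integrable one_le_two).const_mul (t k)
  simp only [← integral_const_mul, ← integral_finsetSum _ fun k _ => integrable_coord k]
  simp [PiLp.inner_apply]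

lemma integral_inner_sq_eq_sum (hν : MemLp id 2 ν) (t : EuclideanSpace ℝ ι) :
    ∫ y, inner ℝ y t ^ 2 ∂ν = ∑ k, ∑ l, t k * t l * ∫ y, y k * y l ∂ν := by
  have integrable_coord_mul (k l : ι) :
      Integrable (fun y : EuclideanSpace ℝ ι => t k * t l * (y k * y l)) ν :=
    ((hν.eval_piLp k).integrable_mul (hν.eval_piLp l)).const_mul (t k * t l)
  simp only [← integral_const_mul]
  rw [Finset.sum_congr rfl fun k _ =>
      (integral_finsetSum _ fun l _ => integrable_coord_mul k l).symm,
    ← integral_finsetSum _ fun k _ => integrable_finsetSum _ fun l _ => integrable_coord_mul k l]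
  refine integral_congr_ae (.of_forall fun y => ?_)
  simp only [PiLp.inner_apply, RCLike.inner_apply, conj_trivial, sq, Finset.sum_mul_sum]
  exact Finset.sum_congr rfl fun k _ => Finset.sum_congr rfl fun l _ => by ring

lemma integral_abs_inner_rpow_le {p : ℝ} (hp : 0 < p) (hν : MemLp id (ENNReal.ofReal p) ν)
    (t : EuclideanSpace ℝ ι) :
    ∫ y, |inner ℝ y t| ^ p ∂ν ≤ ‖t‖ ^ p * ∫ y, ‖y‖ ^ p ∂ν := by
  have integrable_inner : Integrable (fun y => |inner ℝ y t| ^ p) ν := by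
    have := (hν.inner_const (𝕜 := ℝ) t).integrable_norm_rpow
      (ENNReal.ofReal_pos.2 hp).ne' ENNReal.ofReal_ne_top
    rwa [ENNReal.toReal_ofReal hp.le] at this
  have integrable_norm : Integrable (fun y => ‖y‖ ^ p) ν := by
    have := hν.integrable_norm_rpow (ENNReal.ofReal_pos.2 hp).ne' ENNReal.ofReal_ne_top
    rwa [ENNReal.toReal_ofReal hp.le] at this
  rw [← integral_const_mul]
  refine integral_mono integrable_inner (integrable_norm.const_mul _) fun y => ?_
  simp only [← Real.mul_rpow (norm_nonneg _) (norm_nonneg _), mul_comm ‖t‖]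
  exact Real.rpow_le_rpow (abs_nonneg _) (abs_real_inner_le_norm y t) hp.le

end Inner

lemma tendsto_normalizedSumLaw [DecidableEq ι] {δ C : ℝ} (hδ : 0 < δ) (hδ1 : δ ≤ 1)
    {V : Matrix ι ι ℝ} (hV : V.PosSemidef) {ν : ℕ → ProbabilityMeasure (EuclideanSpace ℝ ι)}
    {r : ℕ → ℕ} (hr : Tendsto r atTop atTop)
    (memLp : ∀ j, MemLp id (ENNReal.ofReal (2 + δ)) (ν j : Measure (EuclideanSpace ℝ ι)))
    (mean : ∀ k, Tendsto (fun j => √(r j) * ∫ y, y k ∂(ν j : Measure (EuclideanSpace ℝ ι)))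
      atTop (𝓝 0))
    (second : ∀ k l, Tendsto (fun j => ∫ y, y k * y l ∂(ν j : Measure (EuclideanSpace ℝ ι)))
      atTop (𝓝 (V k l)))
    (moment : ∀ᶠ j in atTop, ∫ y, ‖y‖ ^ (2 + δ) ∂(ν j : Measure (EuclideanSpace ℝ ι)) ≤ C) :
    Tendsto (fun j => normalizedSumLaw (ν j) (r j)) atTop
      (𝓝 ⟨multivariateGaussian 0 V, inferInstance⟩) := by
  refine ProbabilityMeasure.tendsto_of_tendsto_charFun fun t => ?_
  set law : ℕ → Measure ℝ := fun j =>
    (ν j : Measure (EuclideanSpace ℝ ι)).map fun y => inner ℝ y t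
  have (j : ℕ) : IsProbabilityMeasure (law j) := Measure.isProbabilityMeasure_map (by fun_prop)
  have integral_law (j : ℕ) {g : ℝ → ℝ} (hg : Measurable g) :
      ∫ x, g x ∂law j = ∫ y, g (inner ℝ y t) ∂(ν j : Measure (EuclideanSpace ℝ ι)) :=
    integral_map (by fun_prop) hg.aestronglyMeasurable
  have memLp_two (j : ℕ) : MemLp id 2 (ν j : Measure (EuclideanSpace ℝ ι)) :=
    (memLp j).mono_exponent
      (by rw [← ENNReal.ofReal_ofNat]; exact ENNReal.ofReal_le_ofReal (by linarith))
  have memLp_law (j : ℕ) : MemLp id (ENNReal.ofReal (2 + δ)) (law j) :=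
    (memLp_map_measure_iff (by fun_prop) (by fun_prop)).2 ((memLp j).inner_const t)
  have mean_law : Tendsto (fun j => √(r j) * ∫ x, x ∂law j) atTop (𝓝 0) := by
    have := tendsto_finsetSum Finset.univ fun k _ => (mean k).const_mul (t k)
    simp only [mul_zero, Finset.sum_const_zero] at this
    refine this.congr fun j => ?_
    rw [integral_law j measurable_id', integral_inner_eq_sum (memLp_two j), Finset.mul_sum]
    simp only [mul_left_comm]
  have second_law : Tendsto (fun j => ∫ x, x ^ 2 ∂law j) atTop (𝓝 (t ⬝ᵥ V.mulVec t)) := by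
    convert tendsto_finsetSum Finset.univ fun k _ => tendsto_finsetSum Finset.univ fun l _ =>
      (second k l).const_mul (t k * t l) using 2 with j
    · rw [integral_law j (measurable_id'.pow_const 2), integral_inner_sq_eq_sum (memLp_two j)]
    · simp only [dotProduct, Matrix.mulVec, Finset.mul_sum]
      exact Finset.sum_congr rfl fun k _ => Finset.sum_congr rfl fun l _ => by ring
  have moment_law : ∀ᶠ j in atTop, ∫ x, |x| ^ (2 + δ) ∂law j ≤ ‖t‖ ^ (2 + δ) * C := by
    filter_upwards [moment] with j hj
    rw [integral_law j (measurable_id'.abs.pow_const _)]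
    exact (integral_abs_inner_rpow_le (by linarith) (memLp j) t).trans (by gcongr)
  have limit := tendsto_charFun_inv_sqrt_pow hδ hδ1 hr memLp_law mean_law second_law moment_law
  simp only [law, charFun_map_inner, ← charFun_normalizedSumLaw] at limit
  simpa [charFun_multivariateGaussian hV] using limit

end CentralLimitTheorem

section EmpiricalMoments

variable {n m : ℕ}

lemma sum_rpow_le_rpow_sum {ι : Type*} (s : Finset ι) {a : ι → ℝ} (ha : ∀ i, 0 ≤ a i) {q : ℝ}
    (hq : 1 ≤ q) : ∑ i ∈ s, a i ^ q ≤ (∑ i ∈ s, a i) ^ q := by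
  classical
  induction s using Finset.induction_on with
  | empty => simp [Real.zero_rpow (by linarith : q ≠ 0)]
  | insert i s his ih =>
    rw [Finset.sum_insert his, Finset.sum_insert his]
    exact (add_le_add_right ih _).trans
      (Real.add_rpow_le_rpow_add (ha i) (Finset.sum_nonneg fun i _ => ha i) hq)

/-- The empirical absolute moment of order `p`, for the sup norm. -/
def absMoment (p : ℝ) (x : Sample n m) : ℝ := (n : ℝ)⁻¹ * ∑ i, ‖x i‖ ^ p

lemma absMoment_nonneg (p : ℝ) (x : Sample n m) : 0 ≤ absMoment p x :=
  mul_nonneg (by positivity) (Finset.sum_nonneg fun _ _ => by positivity)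

lemma mul_absMoment (p : ℝ) (x : Sample n m) : n * absMoment p x = ∑ i, ‖x i‖ ^ p := by
  rcases n.eq_zero_or_pos with rfl | hn
  · simp
  · rw [absMoment, mul_inv_cancel_left₀ (by positivity)]

lemma norm_sampleMean_rpow_le {p : ℝ} (hp : 1 ≤ p) (x : Sample n m) :
    ‖sampleMean x‖ ^ p ≤ absMoment p x := by
  rcases n.eq_zero_or_pos with rfl | hn
  · have : sampleMean x = 0 := funext fun k => by simp [sampleMean]
    simp [this, absMoment, Real.zero_rpow (by linarith : p ≠ 0)]
  have norm_le : ‖sampleMean x‖ ≤ ∑ i, (n : ℝ)⁻¹ * ‖x i‖ := by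
    refine (pi_norm_le_iff_of_nonneg (Finset.sum_nonneg fun _ _ => by positivity)).2 fun k => ?_
    rw [sampleMean, norm_mul, ← Finset.mul_sum, norm_inv, RCLike.norm_natCast]
    gcongr
    exact (norm_sum_le _ _).trans (Finset.sum_le_sum fun i _ => norm_le_pi_norm (x i) k)
  refine (Real.rpow_le_rpow (norm_nonneg _) norm_le (by linarith)).trans ?_
  rw [absMoment, Finset.mul_sum]
  exact Real.rpow_arith_mean_le_arith_mean_rpow _ _ _ (fun _ _ => by positivity)
    (by simp [hn.ne']) (fun _ _ => norm_nonneg _) hp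

lemma absMoment_centred_le {p : ℝ} (hp : 1 ≤ p) (x : Sample n m) :
    absMoment p (centred x) ≤ 2 ^ p * absMoment p x := by
  rcases n.eq_zero_or_pos with rfl | hn
  · simp [absMoment]
  have norm_centred_le (i : Fin n) :
      ‖centred x i‖ ^ p ≤ 2 ^ (p - 1) * (‖x i‖ ^ p + ‖sampleMean x‖ ^ p) := by
    refine (Real.rpow_le_rpow (norm_nonneg _) (norm_sub_le (x i) (sampleMean x))
      (by linarith)).trans ?_
    exact_mod_cast NNReal.rpow_add_le_mul_rpow_add_rpow ‖x i‖₊ ‖sampleMean x‖₊ hp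
  calc absMoment p (centred x)
      ≤ (n : ℝ)⁻¹ * ∑ i, 2 ^ (p - 1) * (‖x i‖ ^ p + ‖sampleMean x‖ ^ p) :=
        mul_le_mul_of_nonneg_left (Finset.sum_le_sum fun i _ => norm_centred_le i) (by positivity)
    _ = 2 ^ (p - 1) * (absMoment p x + ‖sampleMean x‖ ^ p) := by
        rw [← Finset.mul_sum, Finset.sum_add_distrib, absMoment, Finset.sum_const,
          Finset.card_univ, Fintype.card_fin, nsmul_eq_mul]
        field_simp
    _ ≤ 2 ^ (p - 1) * (absMoment p x + absMoment p x) := by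
        gcongr
        exact norm_sampleMean_rpow_le hp x
    _ = 2 ^ p * absMoment p x := by
        rw [Real.rpow_sub_one two_ne_zero]
        ring

lemma absMoment_le_one_add {p q : ℝ} (hp : 0 ≤ p) (hpq : p ≤ q) (x : Sample n m) :
    absMoment p x ≤ 1 + absMoment q x := by
  have rpow_le (i : Fin n) : ‖x i‖ ^ p ≤ 1 + ‖x i‖ ^ q := by
    rcases le_total ‖x i‖ 1 with h | h
    · linarith [Real.rpow_le_one (norm_nonneg _) h hp, Real.rpow_nonneg (norm_nonneg (x i)) q]
    · linarith [Real.rpow_le_rpow_of_exponent_le h hpq]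
  calc absMoment p x ≤ (n : ℝ)⁻¹ * ∑ i, (1 + ‖x i‖ ^ q) :=
        mul_le_mul_of_nonneg_left (Finset.sum_le_sum fun i _ => rpow_le i) (by positivity)
    _ = (n : ℝ)⁻¹ * n + absMoment q x := by
        simp [absMoment, Finset.sum_add_distrib, mul_add]
    _ ≤ 1 + absMoment q x := by
        gcongr
        exact inv_mul_le_one

lemma sum_centred_mul_sq_le {p : ℝ} (hp0 : 0 < p) (hp : p ≤ 4) (x : Sample n m) (k l : Fin m) :
    ∑ i, (centred x i k * centred x i l) ^ 2 ≤ (n * absMoment p (centred x)) ^ (4 / p) := by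
  have one_le_exponent : 1 ≤ 4 / p := (one_le_div hp0).2 hp
  have mul_sq_le (i : Fin n) :
      (centred x i k * centred x i l) ^ 2 ≤ (‖centred x i‖ ^ p) ^ (4 / p) := by
    have rpow_rpow : (‖centred x i‖ ^ p) ^ (4 / p) = (‖centred x i‖ * ‖centred x i‖) ^ 2 := by
      rw [← Real.rpow_mul (norm_nonneg _), mul_div_cancel₀ _ hp0.ne', ← Nat.cast_ofNat (n := 4),
        Real.rpow_natCast]
      ring
    rw [rpow_rpow, ← sq_abs, abs_mul]
    gcongr
    · exact norm_le_pi_norm (centred x i) k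
    · exact norm_le_pi_norm (centred x i) l
  rw [mul_absMoment]
  exact (Finset.sum_le_sum fun i _ => mul_sq_le i).trans
    (sum_rpow_le_rpow_sum _ (fun i => by positivity) one_le_exponent)

end EmpiricalMoments

section LimitLaw

variable {m : ℕ} {S : Matrix (Fin m) (Fin m) ℝ}

/-- The matrix with entries `Sₖₗ² / (Sₖₖ Sₗₗ)`, the squared correlations: up to the factor `1 / m`,
the asymptotic variance matrix of the vector of recentred statistics. -/
def squaredCorr (S : Matrix (Fin m) (Fin m) ℝ) : Matrix (Fin m) (Fin m) ℝ :=
  Matrix.of fun k l => (S k k)⁻¹ * (S l l)⁻¹ * S k l ^ 2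

lemma posDef_squaredCorr (hS : S.PosDef) : (squaredCorr S).PosDef := by
  have squaredCorr_eq : squaredCorr S = (Matrix.diagonal fun k => (S k k)⁻¹).conjTranspose *
      (S.hadamard S) * (Matrix.diagonal fun k => (S k k)⁻¹) := by
    ext k l
    simp only [squaredCorr, Matrix.of_apply, Matrix.diagonal_conjTranspose, Matrix.mul_diagonal,
      Matrix.diagonal_mul, Matrix.hadamard_apply, star_trivial]
    ring
  rw [squaredCorr_eq]
  refine (hS.hadamard hS).conjTranspose_mul_mul_same ?_
  rw [Matrix.mulVec_injective_iff_isUnit, Matrix.isUnit_diagonal, Pi.isUnit_iff]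
  exact fun k => (inv_ne_zero hS.diag_pos.ne').isUnit

/-- The asymptotic variance matrix of the vector of recentred statistics. -/
def limitVar (S : Matrix (Fin m) (Fin m) ℝ) : Matrix (Fin m) (Fin m) ℝ :=
  (m : ℝ)⁻¹ • squaredCorr S

lemma posDef_limitVar [NeZero m] (hS : S.PosDef) : (limitVar S).PosDef :=
  (posDef_squaredCorr hS).smul (inv_pos.2 (Nat.cast_pos.2 (NeZero.pos m)))

/-- The asymptotic law of the vector of recentred statistics. -/
def limitLaw (S : Matrix (Fin m) (Fin m) ℝ) : ProbabilityMeasure (EuclideanSpace ℝ (Fin m)) :=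
  ⟨multivariateGaussian 0 (limitVar S), inferInstance⟩

end LimitLaw

section PairVector

variable {n m : ℕ}

/-- The contribution of one permutation to the vector of recentred statistics, without the
normalization `R^{-1/2}`. -/
def pairVec (x : Sample n m) (σ : Equiv.Perm (Fin n)) : EuclideanSpace ℝ (Fin m) :=
  WithLp.toLp 2 fun k => (√m)⁻¹ * pairTerm x σ k

/-- The law of `pairVec x` under a uniform permutation. -/
def pairVecLaw (x : Sample n m) : ProbabilityMeasure (EuclideanSpace ℝ (Fin m)) :=
  ⟨(permLaw n).map (pairVec x),
    Measure.isProbabilityMeasure_map (measurable_of_finite _).aemeasurable⟩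

lemma integral_pairVecLaw (x : Sample n m) {g : EuclideanSpace ℝ (Fin m) → ℝ} (hg : Measurable g) :
    ∫ y, g y ∂(pairVecLaw x : Measure (EuclideanSpace ℝ (Fin m))) =
      ∫ σ, g (pairVec x σ) ∂permLaw n :=
  integral_map (measurable_of_finite _).aemeasurable hg.aestronglyMeasurable

lemma memLp_id_pairVecLaw (x : Sample n m) (p : ℝ≥0∞) :
    MemLp id p (pairVecLaw x : Measure (EuclideanSpace ℝ (Fin m))) :=
  (memLp_map_measure_iff (by fun_prop) (measurable_of_finite _).aemeasurable).2 .of_discrete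

lemma norm_le_sum_norm_apply {ι : Type*} [Fintype ι] (y : EuclideanSpace ℝ ι) :
    ‖y‖ ≤ ∑ k, ‖y k‖ := by
  classical
  nth_rw 1 [← (EuclideanSpace.basisFun ι ℝ).sum_repr y]
  refine (norm_sum_le _ _).trans_eq (Finset.sum_congr rfl fun k _ => ?_)
  simp [norm_smul]

lemma norm_pairVec_le (hn : 2 ≤ n) (x : Sample n m) (σ : Equiv.Perm (Fin n)) :
    ‖pairVec x σ‖ ≤ (∑ k, (√m)⁻¹ * |(sampleVar x k k)⁻¹|) *
      (‖centred x (σ ⟨0, by lia⟩)‖ * ‖centred x (σ ⟨1, by lia⟩)‖) := by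
  refine (norm_le_sum_norm_apply _).trans ?_
  rw [Finset.sum_mul]
  refine Finset.sum_le_sum fun k _ => ?_
  calc ‖(√m)⁻¹ * pairTerm x σ k‖
      = (√m)⁻¹ * |(sampleVar x k k)⁻¹| *
          (‖centred x (σ ⟨0, by lia⟩) k‖ * ‖centred x (σ ⟨1, by lia⟩) k‖) := by
        rw [pairTerm_eq hn, norm_mul, norm_mul, norm_mul, Real.norm_of_nonneg (by positivity),
          Real.norm_eq_abs (sampleVar x k k)⁻¹]
        ring
    _ ≤ _ := by
        gcongr
        · exact norm_le_pi_norm (centred x _) k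
        · exact norm_le_pi_norm (centred x _) k

lemma integral_norm_pairVec_rpow_le (hn : 2 ≤ n) (x : Sample n m) {p : ℝ} (hp : 1 ≤ p) :
    ∫ σ, ‖pairVec x σ‖ ^ p ∂permLaw n ≤
      (∑ k, (√m)⁻¹ * |(sampleVar x k k)⁻¹|) ^ p * (2 * (2 ^ p * absMoment p x) ^ 2) := by
  set c := ∑ k, (√m)⁻¹ * |(sampleVar x k k)⁻¹|
  have c_nonneg : 0 ≤ c := Finset.sum_nonneg fun k _ => by positivity
  calc ∫ σ, ‖pairVec x σ‖ ^ p ∂permLaw n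
      ≤ ∫ σ, c ^ p * (‖centred x (σ ⟨0, by lia⟩)‖ ^ p * ‖centred x (σ ⟨1, by lia⟩)‖ ^ p)
          ∂permLaw n := by
        refine integral_mono .of_finite .of_finite fun σ => ?_
        simp only
        rw [← Real.mul_rpow (norm_nonneg _) (norm_nonneg _),
          ← Real.mul_rpow c_nonneg (by positivity)]
        exact Real.rpow_le_rpow (norm_nonneg _) (norm_pairVec_le hn x σ) (by linarith)
    _ ≤ c ^ p * (2 * absMoment p (centred x) ^ 2) := by
        rw [integral_const_mul]
        gcongr
        exact integral_mul_apply_pair_le (by simp) fun i => ‖centred x i‖ ^ p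
    _ ≤ c ^ p * (2 * (2 ^ p * absMoment p x) ^ 2) := by
        gcongr
        · exact absMoment_nonneg p _
        · exact absMoment_centred_le hp x

end PairVector

section RegularArrays

/-- An array of nonrandom samples, and of numbers of draws, along which the conditional law of the
recentred statistics converges: the bounds hold in probability along a regular sequence. -/
structure RegularArray {m : ℕ} (δ M : ℝ) (S : Matrix (Fin m) (Fin m) ℝ) (N R : ℕ → ℕ)
    (x : ∀ j, Sample (N j) m) : Prop where
  size : Tendsto N atTop atTop
  draws : Tendsto R atTop atTop
  sqrt_draws_div_size : Tendsto (fun j => √(R j) / N j) atTop (𝓝 0)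
  var : ∀ k l, Tendsto (fun j => sampleVar (x j) k l) atTop (𝓝 (S k l))
  moment : ∀ᶠ j in atTop, absMoment (2 + δ) (x j) ≤ M

namespace RegularArray

variable {m : ℕ} {δ M : ℝ} {S : Matrix (Fin m) (Fin m) ℝ} {N R : ℕ → ℕ} {x : ∀ j, Sample (N j) m}

lemma mono_exponent (h : RegularArray δ M S N R x) {δ' : ℝ} (hδ' : 0 ≤ δ') (hδ'δ : δ' ≤ δ) :
    RegularArray δ' (1 + M) S N R x where
  __ := h
  moment := h.moment.mono fun j hj =>
    (absMoment_le_one_add (by linarith) (by linarith) (x j)).trans (add_le_add_right hj 1)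

lemma tendsto_size (h : RegularArray δ M S N R x) : Tendsto (fun j => (N j : ℝ)) atTop atTop :=
  tendsto_natCast_atTop_atTop.comp h.size

lemma tendsto_size_div_size_sub_one (h : RegularArray δ M S N R x) :
    Tendsto (fun j => (N j : ℝ) / (N j - 1)) atTop (𝓝 1) := by
  have limit : Tendsto (fun j => (1 - (N j : ℝ)⁻¹)⁻¹) atTop (𝓝 1) := by
    simpa using ((tendsto_inv_atTop_zero.comp h.tendsto_size).const_sub 1).inv₀ (by simp)
  refine limit.congr' ?_
  filter_upwards [h.tendsto_size.eventually_gt_atTop 1] with j hj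
  have : (N j : ℝ) - 1 ≠ 0 := by linarith
  field_simp

lemma tendsto_sum_centred_mul_sq (h : RegularArray δ M S N R x) (hδ : 0 < δ) (hδ1 : δ ≤ 1)
    (k l : Fin m) : Tendsto (fun j => ((N j : ℝ)⁻¹) ^ 2 *
      ∑ i, (centred (x j) i k * centred (x j) i l) ^ 2) atTop (𝓝 0) := by
  set p := 2 + δ
  have exponent_pos : 0 < 2 - 4 / p := by
    rw [sub_pos, div_lt_iff₀ (by linarith)]
    linarith
  have bound_tendsto :
      Tendsto (fun j => (N j : ℝ) ^ (-(2 - 4 / p)) * (2 ^ p * M) ^ (4 / p)) atTop (𝓝 0) := by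
    simpa using ((tendsto_rpow_neg_atTop exponent_pos).comp h.tendsto_size).mul_const _
  refine squeeze_zero' (.of_forall fun j => by positivity) ?_ bound_tendsto
  filter_upwards [h.moment, h.size.eventually_gt_atTop 0] with j hj hN
  have size_pos : (0 : ℝ) < N j := Nat.cast_pos.2 hN
  have centred_moment : absMoment p (centred (x j)) ≤ 2 ^ p * M :=
    (absMoment_centred_le (by linarith) (x j)).trans (by gcongr)
  calc ((N j : ℝ)⁻¹) ^ 2 * ∑ i, (centred (x j) i k * centred (x j) i l) ^ 2
      ≤ ((N j : ℝ)⁻¹) ^ 2 * (N j * absMoment p (centred (x j))) ^ (4 / p) := by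
        gcongr
        exact sum_centred_mul_sq_le (by linarith) (by linarith) (x j) k l
    _ = (N j : ℝ) ^ (-(2 - 4 / p)) * absMoment p (centred (x j)) ^ (4 / p) := by
        rw [Real.mul_rpow size_pos.le (absMoment_nonneg _ _), neg_sub, Real.rpow_sub size_pos,
          Real.rpow_two]
        field_simp
    _ ≤ (N j : ℝ) ^ (-(2 - 4 / p)) * (2 ^ p * M) ^ (4 / p) := by
        gcongr
        exact absMoment_nonneg _ _

lemma tendsto_integral_pairTerm_mul (h : RegularArray δ M S N R x) (hδ : 0 < δ) (hδ1 : δ ≤ 1)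
    (hS : ∀ k, S k k ≠ 0) (k l : Fin m) :
    Tendsto (fun j => ∫ σ, pairTerm (x j) σ k * pairTerm (x j) σ l ∂permLaw (N j)) atTop
      (𝓝 (squaredCorr S k l)) := by
  have limit := (((h.var k k).inv₀ (hS k)).mul ((h.var l l).inv₀ (hS l))).mul
    (h.tendsto_size_div_size_sub_one.mul
      (((h.var k l).pow 2).sub (h.tendsto_sum_centred_mul_sq hδ hδ1 k l)))
  rw [one_mul, sub_zero] at limit
  refine limit.congr' ?_
  filter_upwards [h.tendsto_size.eventually_ge_atTop 2] with j hj
  have size_ne : (N j : ℝ) ≠ 0 := by linarith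
  have size_sub_one_ne : (N j : ℝ) - 1 ≠ 0 := by linarith
  refine mul_left_cancel₀ (mul_ne_zero size_ne size_sub_one_ne) ?_
  rw [integral_pairTerm_mul (by exact_mod_cast hj)]
  generalize (∑ i, (centred (x j) i k * centred (x j) i l) ^ 2) = fourth
  generalize (sampleVar (x j) k k)⁻¹ * (sampleVar (x j) l l)⁻¹ = scale
  field_simp

lemma tendsto_integral_pairTerm (h : RegularArray δ M S N R x) (k : Fin m) :
    Tendsto (fun j => √(R j) * ∫ σ, pairTerm (x j) σ k ∂permLaw (N j)) atTop (𝓝 0) := by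
  have bound_tendsto := h.sqrt_draws_div_size.mul h.tendsto_size_div_size_sub_one
  rw [zero_mul] at bound_tendsto
  refine squeeze_zero_norm' ?_ bound_tendsto
  filter_upwards [h.tendsto_size.eventually_ge_atTop 2] with j hj
  have size_sub_one_pos : 0 < (N j : ℝ) - 1 := by linarith
  have abs_integral_le : ((N j : ℝ) - 1) * |∫ σ, pairTerm (x j) σ k ∂permLaw (N j)| ≤ 1 := by
    rw [← abs_of_pos size_sub_one_pos, ← abs_mul,
      integral_pairTerm (by exact_mod_cast hj), abs_neg]
    rcases eq_or_ne (sampleVar (x j) k k) 0 with hv | hv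
    · simp [hv]
    · simp [mul_inv_cancel₀ hv]
  have size_ne : (N j : ℝ) ≠ 0 := by linarith
  rw [norm_mul, Real.norm_of_nonneg (Real.sqrt_nonneg _), Real.norm_eq_abs,
    div_mul_div_cancel₀ size_ne, div_eq_mul_one_div]
  gcongr
  rwa [le_div_iff₀' size_sub_one_pos]

end RegularArray

end RegularArrays

section ConditionalLaw

/-- The vector of recentred statistics. -/
def centredVec {n m R : ℕ} (x : Sample n m) (π : Draws n R) : EuclideanSpace ℝ (Fin m) :=
  WithLp.toLp 2 fun k => uStat x π k (sampleMean x k)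

lemma centredVec_eq {n m R : ℕ} (x : Sample n m) (π : Draws n R) :
    centredVec x π = (√R)⁻¹ • ∑ r, pairVec x (π r) := by
  ext k
  simp only [centredVec, uStat_sampleMean, pairVec, PiLp.smul_apply, PiLp.toLp_apply,
    WithLp.ofLp_sum, Finset.sum_apply, smul_eq_mul, ← Finset.mul_sum]
  rw [Real.sqrt_mul (Nat.cast_nonneg m), mul_inv]
  ring

/-- The law of the recentred statistics when the data are held fixed. -/
def centredLaw {n m : ℕ} (R : ℕ) (x : Sample n m) : ProbabilityMeasure (EuclideanSpace ℝ (Fin m)) :=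
  ⟨(drawLaw n R).map (centredVec x),
    Measure.isProbabilityMeasure_map (measurable_of_finite _).aemeasurable⟩

lemma centredLaw_eq_normalizedSumLaw {n m : ℕ} (R : ℕ) (x : Sample n m) :
    centredLaw R x = normalizedSumLaw (pairVecLaw x) R := by
  refine Subtype.ext ?_
  have pi_map : Measure.pi (fun _ : Fin R => (permLaw n).map (pairVec x)) =
      (drawLaw n R).map fun π r => pairVec x (π r) :=
    (Measure.pi_map_pi fun _ => (measurable_of_finite _).aemeasurable).symm
  simp only [centredLaw, normalizedSumLaw, pairVecLaw, ProbabilityMeasure.coe_mk, pi_map]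
  rw [Measure.map_map (by fun_prop) (measurable_of_finite _)]
  exact congrArg (fun f => Measure.map f _) (funext fun π => centredVec_eq x π)

namespace RegularArray

variable {m : ℕ} {δ M : ℝ} {S : Matrix (Fin m) (Fin m) ℝ} {N R : ℕ → ℕ} {x : ∀ j, Sample (N j) m}

lemma tendsto_centredLaw_of_le_one [NeZero m] (h : RegularArray δ M S N R x) (hδ : 0 < δ)
    (hδ1 : δ ≤ 1) (hS : S.PosDef) :
    Tendsto (fun j => centredLaw (R j) (x j)) atTop (𝓝 (limitLaw S)) := by
  have diag_ne (k : Fin m) : S k k ≠ 0 := hS.diag_pos.ne'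
  have scale_tendsto : Tendsto (fun j => ∑ k, (√m)⁻¹ * |(sampleVar (x j) k k)⁻¹|) atTop
      (𝓝 (∑ k, (√m)⁻¹ * |(S k k)⁻¹|)) :=
    tendsto_finsetSum _ fun k _ => ((h.var k k).inv₀ (diag_ne k)).abs.const_mul _
  simp only [centredLaw_eq_normalizedSumLaw]
  refine tendsto_normalizedSumLaw hδ hδ1 (posDef_limitVar hS).posSemidef h.draws
    (fun j => memLp_id_pairVecLaw (x j) _) (fun k => ?_) (fun k l => ?_)
    (C := (∑ k, (√m)⁻¹ * |(S k k)⁻¹| + 1) ^ (2 + δ) * (2 * (2 ^ (2 + δ) * M) ^ 2)) ?_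
  · have limit := (h.tendsto_integral_pairTerm k).const_mul (√m)⁻¹
    rw [mul_zero] at limit
    refine limit.congr fun j => ?_
    rw [integral_pairVecLaw _ (by fun_prop)]
    simp only [pairVec, PiLp.toLp_apply, integral_const_mul]
    ring
  · refine ((h.tendsto_integral_pairTerm_mul hδ hδ1 diag_ne k l).const_mul (m : ℝ)⁻¹).congr
      fun j => ?_
    rw [integral_pairVecLaw _ (by fun_prop), ← integral_const_mul]
    refine integral_congr_ae (.of_forall fun σ => ?_)
    simp only [pairVec, PiLp.toLp_apply, mul_mul_mul_comm (√m)⁻¹, ← mul_inv,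
      Real.mul_self_sqrt (Nat.cast_nonneg m)]
  · filter_upwards [h.moment, h.size.eventually_ge_atTop 2,
      scale_tendsto.eventually_le_const (lt_add_one _)] with j moment_le hj scale_le
    rw [integral_pairVecLaw _ (by fun_prop)]
    refine (integral_norm_pairVec_rpow_le hj (x j) (by linarith)).trans ?_
    have := absMoment_nonneg (2 + δ) (x j)
    gcongr

lemma tendsto_centredLaw [NeZero m] (h : RegularArray δ M S N R x) (hδ : 0 < δ) (hS : S.PosDef) :
    Tendsto (fun j => centredLaw (R j) (x j)) atTop (𝓝 (limitLaw S)) :=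
  (h.mono_exponent (le_min hδ.le zero_le_one) (min_le_left δ 1)).tendsto_centredLaw_of_le_one
    (lt_min hδ one_pos) (min_le_right δ 1) hS

end RegularArray

end ConditionalLaw

lemma tendsto_measureReal_le_atBot {Ω : Type*} [MeasurableSpace Ω] {μ : Measure Ω}
    [IsFiniteMeasure μ] {f : Ω → ℝ} (hf : Measurable f) :
    Tendsto (fun c : ℝ => μ.real {ω | f ω ≤ c}) atBot (𝓝 0) := by
  rw [← measureReal_empty (μ := μ)]
  refine (ENNReal.tendsto_toReal (measure_ne_top _ _)).comp
    (tendsto_measure_of_ae_tendsto_indicator_of_isFiniteMeasure _ .empty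
      (fun c => measurableSet_le hf measurable_const) (ae_of_all _ fun ω => ?_))
  filter_upwards [eventually_lt_atBot (f ω)] with c hc
  simpa using hc

section JointCdf

variable {ι : Type*} {ν : Measure (EuclideanSpace ℝ ι)}

/-- The joint distribution function of a measure on a Euclidean space. -/
def jointCdf (ν : Measure (EuclideanSpace ℝ ι)) (a : ι → ℝ) : ℝ :=
  ν.real {w | ∀ k, w k ≤ a k}

lemma tendsto_jointCdf_const_atBot [Nonempty ι] [IsFiniteMeasure ν] :
    Tendsto (fun c : ℝ => jointCdf ν fun _ => c) atBot (𝓝 0) :=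
  squeeze_zero (fun _ => measureReal_nonneg)
    (fun _ => measureReal_mono fun _ hw => hw (Classical.arbitrary ι))
    (tendsto_measureReal_le_atBot (by fun_prop))

variable [Finite ι]

lemma measurableSet_orthant (a : ι → ℝ) :
    MeasurableSet {w : EuclideanSpace ℝ ι | ∀ k, w k ≤ a k} := by
  rw [Set.ofPred_forall]
  exact .iInter fun k => measurableSet_le (by fun_prop) (by fun_prop)

lemma isOpen_openOrthant (a : ι → ℝ) :
    IsOpen {w : EuclideanSpace ℝ ι | ∀ k, w k < a k} := by
  rw [Set.ofPred_forall]
  exact isOpen_iInter_of_finite fun k => isOpen_lt (by fun_prop) (by fun_prop)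

lemma frontier_orthant_subset (a : ι → ℝ) :
    frontier {w : EuclideanSpace ℝ ι | ∀ k, w k ≤ a k} ⊆ ⋃ k, {w | w k = a k} := by
  have isClosed_orthant : IsClosed {w : EuclideanSpace ℝ ι | ∀ k, w k ≤ a k} := by
    rw [Set.ofPred_forall]
    exact isClosed_iInter fun k => isClosed_le (by fun_prop) (by fun_prop)
  intro w hw
  rw [isClosed_orthant.frontier_eq] at hw
  by_contra hne
  simp only [Set.mem_iUnion, Set.mem_ofPred_eq, not_exists] at hne
  exact hw.2 (interior_maximal (fun v hv k => (hv k).le) (isOpen_openOrthant a)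
    fun k => lt_of_le_of_ne (hw.1 k) (hne k))

lemma continuous_jointCdf [IsFiniteMeasure ν] (hν : ∀ k a, ν {w | w k = a} = 0) :
    Continuous (jointCdf ν) := by
  refine continuous_iff_continuousAt.2 fun a => (ENNReal.tendsto_toReal (measure_ne_top _ _)).comp
    (tendsto_measure_of_ae_tendsto_indicator_of_isFiniteMeasure _ (measurableSet_orthant a)
      measurableSet_orthant ?_)
  have ae_ne : ∀ᵐ w ∂ν, ∀ k, w k ≠ a k :=
    ae_all_iff.2 fun k => ae_iff.2 (by simpa only [not_not] using hν k (a k))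
  filter_upwards [ae_ne] with w hw
  have eventually_le_iff (k : ι) : ∀ᶠ b in 𝓝 a, (w k ≤ b k ↔ w k ≤ a k) := by
    have tendsto_apply : Tendsto (fun b : ι → ℝ => b k) (𝓝 a) (𝓝 (a k)) :=
      (continuous_apply k).tendsto a
    rcases lt_or_gt_of_ne (hw k) with hlt | hgt
    · filter_upwards [tendsto_apply.eventually_const_lt hlt] with b hb
      exact iff_of_true hb.le hlt.le
    · filter_upwards [tendsto_apply.eventually_lt_const hgt] with b hb
      exact iff_of_false hb.not_ge hgt.not_ge
  filter_upwards [eventually_all.2 eventually_le_iff] with b hb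
  exact forall_congr' hb

lemma strictMono_jointCdf [IsFiniteMeasure ν] [ν.IsOpenPosMeasure] : StrictMono (jointCdf ν) := by
  intro a b hab
  obtain ⟨hle, k, hk⟩ := Pi.lt_def.1 hab
  set U : Set (EuclideanSpace ℝ ι) := {w | (∀ l, w l < b l) ∧ a k < w k}
  have isOpen_U : IsOpen U := (isOpen_openOrthant b).inter
    (isOpen_Ioi.preimage (by fun_prop : Continuous fun w : EuclideanSpace ℝ ι => w k))
  have nonempty_U : U.Nonempty := by
    obtain ⟨c, hac, hcb⟩ := exists_between hk
    classical
    refine ⟨WithLp.toLp 2 fun l => if l = k then c else b l - 1, fun l => ?_, by simpa using hac⟩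
    rcases eq_or_ne l k with rfl | hl
    · simpa using hcb
    · simp [hl]
  have disjoint_U : Disjoint {w : EuclideanSpace ℝ ι | ∀ k, w k ≤ a k} U :=
    Set.disjoint_left.2 fun w hw hwU => (hw k).not_gt hwU.2
  have union_subset : {w | ∀ k, w k ≤ a k} ∪ U ⊆ {w | ∀ k, w k ≤ b k} := by
    rintro w (hw | hw) l
    · exact (hw l).trans (hle l)
    · exact (hw.1 l).le
  calc jointCdf ν a < jointCdf ν a + ν.real U :=
        lt_add_of_pos_right _ (ENNReal.toReal_pos (isOpen_U.measure_ne_zero ν nonempty_U)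
          (measure_ne_top _ _))
    _ = ν.real ({w | ∀ k, w k ≤ a k} ∪ U) :=
        (measureReal_union disjoint_U isOpen_U.measurableSet).symm
    _ ≤ jointCdf ν b := measureReal_mono union_subset

lemma tendsto_jointCdf_const_atTop [IsProbabilityMeasure ν] :
    Tendsto (fun c : ℝ => jointCdf ν fun _ => c) atTop (𝓝 1) := by
  rw [← probReal_univ (μ := ν)]
  refine (ENNReal.tendsto_toReal (measure_ne_top _ _)).comp
    (tendsto_measure_of_ae_tendsto_indicator_of_isFiniteMeasure _ .univ
      (fun c => measurableSet_orthant fun _ => c) (ae_of_all _ fun w => ?_))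
  filter_upwards [eventually_all.2 fun k => eventually_ge_atTop (w k)] with c hc
  simpa using hc

lemma exists_jointCdf_const_eq [Nonempty ι] [IsProbabilityMeasure ν]
    (hν : ∀ k a, ν {w | w k = a} = 0) {p : ℝ} (hp0 : 0 < p) (hp1 : p < 1) :
    ∃ q : ℝ, jointCdf ν (fun _ => q) = p :=
  mem_range_of_exists_le_of_exists_ge (f := fun q : ℝ => jointCdf ν fun _ => q)
    ((continuous_jointCdf hν).comp (by fun_prop))
    (tendsto_jointCdf_const_atBot.eventually_le_const hp0).exists
    (tendsto_jointCdf_const_atTop.eventually_const_le hp1).exists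

section

variable {β : Type*} {l : Filter β} {P : β → ProbabilityMeasure (EuclideanSpace ℝ ι)}
  {Q : ProbabilityMeasure (EuclideanSpace ℝ ι)}

lemma tendsto_jointCdf (h : Tendsto P l (𝓝 Q))
    (hQ : ∀ k a, (Q : Measure (EuclideanSpace ℝ ι)) {w | w k = a} = 0) (a : ι → ℝ) :
    Tendsto (fun j => jointCdf (P j : Measure (EuclideanSpace ℝ ι)) a) l (𝓝 (jointCdf Q a)) :=
  (ENNReal.tendsto_toReal (measure_ne_top _ _)).comp
    (ProbabilityMeasure.tendsto_measure_of_null_frontier_of_tendsto' h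
      (measure_mono_null (frontier_orthant_subset a) (measure_iUnion_null fun k => hQ k (a k))))

lemma tendsto_measureReal_eval_le (h : Tendsto P l (𝓝 Q))
    (hQ : ∀ k a, (Q : Measure (EuclideanSpace ℝ ι)) {w | w k = a} = 0) (k : ι) (c : ℝ) :
    Tendsto (fun j => (P j : Measure (EuclideanSpace ℝ ι)).real {w | w k ≤ c}) l
      (𝓝 ((Q : Measure (EuclideanSpace ℝ ι)).real {w | w k ≤ c})) :=
  (ENNReal.tendsto_toReal (measure_ne_top _ _)).comp
    (ProbabilityMeasure.tendsto_measure_of_null_frontier_of_tendsto' h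
      (measure_mono_null (frontier_le_subset_eq (by fun_prop) (by fun_prop)) (hQ k c)))

end

end JointCdf

section NondegenerateGaussian

variable {ι : Type*} [Fintype ι]

instance : (stdGaussian (EuclideanSpace ℝ ι)).IsOpenPosMeasure := by
  rw [← map_pi_eq_stdGaussian]
  have : (gaussianReal 0 1).IsOpenPosMeasure :=
    (gaussianReal_absolutelyContinuous' 0 one_ne_zero).isOpenPosMeasure
  exact (PiLp.continuous_toLp 2 _).isOpenPosMeasure_map (WithLp.toLp_surjective 2)

variable [DecidableEq ι]

open scoped MatrixOrder in
lemma isOpenPosMeasure_multivariateGaussian {V : Matrix ι ι ℝ} (hV : V.PosDef)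
    (μ : EuclideanSpace ℝ ι) : (multivariateGaussian μ V).IsOpenPosMeasure := by
  refine Continuous.isOpenPosMeasure_map (by fun_prop) fun y => ?_
  have isUnit_sqrt : IsUnit (CFC.sqrt V) := by
    have := hV.isUnit
    rw [← CFC.sqrt_mul_sqrt_self V hV.posSemidef.nonneg] at this
    exact isUnit_of_mul_isUnit_left this
  obtain ⟨u, hu⟩ := isUnit_sqrt.map (Matrix.toEuclideanCLM (n := ι) (𝕜 := ℝ))
  refine ⟨(↑u⁻¹ : EuclideanSpace ℝ ι →L[ℝ] EuclideanSpace ℝ ι) (y - μ), ?_⟩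
  simp only [← hu, ← mul_apply_eq_comp, Units.mul_inv, one_apply_eq_self, add_sub_cancel]

lemma multivariateGaussian_eval_eq {V : Matrix ι ι ℝ} (hV : V.PosDef) (μ : EuclideanSpace ℝ ι)
    (k : ι) (a : ℝ) : multivariateGaussian μ V {w | w k = a} = 0 := by
  have := nullSingletonClass_gaussianReal (μ := μ k) (v := (V k k).toNNReal)
    (by simpa using hV.diag_pos)
  rw [← measure_singleton (μ := gaussianReal (μ k) (V k k).toNNReal) a]
  exact (measurePreserving_eval_multivariateGaussian hV.posSemidef).measure_preimage
    (measurableSet_singleton a).nullMeasurableSet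

end NondegenerateGaussian

section LimitLaw

variable {m : ℕ} [NeZero m] {S : Matrix (Fin m) (Fin m) ℝ}

lemma isOpenPosMeasure_limitLaw (hS : S.PosDef) :
    (limitLaw S : Measure (EuclideanSpace ℝ (Fin m))).IsOpenPosMeasure :=
  isOpenPosMeasure_multivariateGaussian (posDef_limitVar hS) 0

lemma limitLaw_eval_eq (hS : S.PosDef) (k : Fin m) (a : ℝ) :
    (limitLaw S : Measure (EuclideanSpace ℝ (Fin m))) {w | w k = a} = 0 :=
  multivariateGaussian_eval_eq (posDef_limitVar hS) 0 k a

end LimitLaw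

/-- The lower `p`-quantile of a probability measure on the line. -/
def lowerQuantile (μ : Measure ℝ) (p : ℝ) : ℝ :=
  sInf {c | p ≤ cdf μ c}

lemma lowerQuantile_le_iff (μ : Measure ℝ) {p c : ℝ} (hp0 : 0 < p) (hp1 : p < 1) :
    lowerQuantile μ p ≤ c ↔ p ≤ cdf μ c := by
  have bddBelow : BddBelow {c | p ≤ cdf μ c} := by
    obtain ⟨b, hb⟩ := ((tendsto_cdf_atBot μ).eventually_lt_const hp0).exists
    exact ⟨b, fun c hc => ((monotone_cdf μ).reflect_lt (hb.trans_le hc)).le⟩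
  have nonempty : {c | p ≤ cdf μ c}.Nonempty :=
    ((tendsto_cdf_atTop μ).eventually_const_le hp1).exists
  refine ⟨fun hc => ?_, fun hc => csInf_le bddBelow hc⟩
  by_contra! hlt
  obtain ⟨d, hd, hcd⟩ := ((((cdf μ).right_continuous c).mono
    Set.Ioi_subset_Ici_self).eventually_lt_const hlt |>.and self_mem_nhdsWithin).exists
  have le_quantile : d ≤ lowerQuantile μ p :=
    le_csInf nonempty fun b hb => ((monotone_cdf μ).reflect_lt (hd.trans_le hb)).le
  exact (hc.trans_lt hcd).not_ge le_quantile

lemma tendsto_lowerQuantile {β : Type*} {l : Filter β} {μ : β → Measure ℝ} {F : ℝ → ℝ} {p q : ℝ}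
    (hF : StrictMono F) (h : ∀ c, Tendsto (fun j => cdf (μ j) c) l (𝓝 (F c)))
    (hp0 : 0 < p) (hp1 : p < 1) (hq : F q = p) :
    Tendsto (fun j => lowerQuantile (μ j) p) l (𝓝 q) := by
  refine tendsto_order.2 ⟨fun a ha => ?_, fun b hb => ?_⟩
  · filter_upwards [(h a).eventually_lt_const (hq ▸ hF ha)] with j hj
    exact lt_of_not_ge fun hle => hj.not_ge ((lowerQuantile_le_iff _ hp0 hp1).1 hle)
  · obtain ⟨c, hqc, hcb⟩ := exists_between hb
    filter_upwards [(h c).eventually_const_lt (hq ▸ hF hqc)] with j hj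
    exact ((lowerQuantile_le_iff _ hp0 hp1).2 hj.le).trans_lt hcb

section CriticalValue

variable {n m R : ℕ}

lemma cdf_map_centredStat (R : ℕ) (x : Sample n m) (c : ℝ) :
    cdf ((drawLaw n R).map (centredStat x)) c = (drawLaw n R).real {π | centredStat x π ≤ c} := by
  have := Measure.isProbabilityMeasure_map (μ := drawLaw n R)
    (measurable_of_finite (centredStat x)).aemeasurable
  rw [cdf_eq_real]
  exact map_measureReal_apply (measurable_of_finite _) measurableSet_Iic

lemma critVal_eq_lowerQuantile (R : ℕ) (α : ℝ) (x : Sample n m) :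
    critVal R α x = lowerQuantile ((drawLaw n R).map (centredStat x)) (1 - α) := by
  simp only [critVal, lowerQuantile, cdf_map_centredStat]

lemma critVal_le_iff {α c : ℝ} (hα0 : 0 < α) (hα1 : α < 1) (x : Sample n m) :
    critVal R α x ≤ c ↔ 1 - α ≤ (drawLaw n R).real {π | centredStat x π ≤ c} := by
  rw [critVal_eq_lowerQuantile, lowerQuantile_le_iff _ (by linarith) (by linarith),
    cdf_map_centredStat]

lemma measureReal_centredVec_mem (R : ℕ) (x : Sample n m) {A : Set (EuclideanSpace ℝ (Fin m))}
    (hA : MeasurableSet A) :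
    (drawLaw n R).real {π | centredVec x π ∈ A}
      = (centredLaw R x : Measure (EuclideanSpace ℝ (Fin m))).real A :=
  (map_measureReal_apply (measurable_of_finite _) hA).symm

lemma measureReal_centredStat_le [NeZero m] (R : ℕ) (x : Sample n m) (c : ℝ) :
    (drawLaw n R).real {π | centredStat x π ≤ c}
      = jointCdf (centredLaw R x : Measure (EuclideanSpace ℝ (Fin m))) fun _ => c := by
  have centredStat_le_iff (π : Draws n R) :
      centredStat x π ≤ c ↔ centredVec x π ∈ {w : EuclideanSpace ℝ (Fin m) | ∀ k, w k ≤ c} :=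
    ciSup_le_iff (Set.finite_range _).bddAbove
  simp only [centredStat_le_iff]
  exact measureReal_centredVec_mem R x (measurableSet_orthant _)

lemma tendsto_critVal [NeZero m] {S : Matrix (Fin m) (Fin m) ℝ} {N R : ℕ → ℕ}
    {x : ∀ j, Sample (N j) m} (hS : S.PosDef) {α q : ℝ} (hα0 : 0 < α) (hα1 : α < 1)
    (hq : jointCdf (limitLaw S : Measure (EuclideanSpace ℝ (Fin m))) (fun _ => q) = 1 - α)
    (h : Tendsto (fun j => centredLaw (R j) (x j)) atTop (𝓝 (limitLaw S))) :
    Tendsto (fun j => critVal (R j) α (x j)) atTop (𝓝 q) := by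
  have := isOpenPosMeasure_limitLaw hS
  simp only [critVal_eq_lowerQuantile]
  refine tendsto_lowerQuantile (strictMono_jointCdf.comp Function.const_strictMono) (fun c => ?_)
    (by linarith) (by linarith) hq
  simp only [cdf_map_centredStat, measureReal_centredStat_le]
  exact tendsto_jointCdf h (limitLaw_eval_eq hS) _

end CriticalValue

section LinearStatistic

variable {n m R : ℕ}

/-- The normalized sum of the centred draws: the part of the test statistic that is linear in the
data, and the only source of randomness in its shift away from the recentred statistic. -/
def linStat (x : Sample n m) (π : Draws n R) (k : Fin m) : ℝ :=
  (√(m * R))⁻¹ * ∑ r, sumTerm x (π r) k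

/-- The positive part of the scaled sample mean `R^{1/4} X̄ₖ`, the quantity through which the
slackness of the `k`-th inequality enters the test. -/
def posScaledMean (R : ℕ) (x : Sample n m) (k : Fin m) : ℝ :=
  max ((R : ℝ) ^ (1 / 4 : ℝ) * sampleMean x k) 0

/-- The difference between the components of the test statistic and the recentred statistics. -/
def shift (x : Sample n m) (π : Draws n R) (k : Fin m) : ℝ :=
  (sampleVar x k k)⁻¹ * (max (sampleMean x k) 0 * linStat x π k
    + √(R / m) * max (sampleMean x k) 0 ^ 2)

lemma inv_sqrt_mul_mul (m R : ℕ) : (√(m * R : ℝ))⁻¹ * R = √(R / m : ℝ) := by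
  rw [Real.sqrt_mul (Nat.cast_nonneg m), Real.sqrt_div (Nat.cast_nonneg R), mul_inv, mul_assoc,
    inv_mul_eq_div (√(R : ℝ)), Real.div_sqrt, div_eq_inv_mul]

lemma sqrt_eq_rpow_quarter_sq (R : ℕ) : √(R : ℝ) = ((R : ℝ) ^ (1 / 4 : ℝ)) ^ 2 := by
  rw [Real.sqrt_eq_rpow, ← Real.rpow_natCast, ← Real.rpow_mul (Nat.cast_nonneg R)]
  norm_num

lemma lambdaHat_eq (x : Sample n m) (π : Draws n R) (k : Fin m) :
    lambdaHat x π k = (sampleVar x k k)⁻¹ * (sampleMean x k * linStat x π k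
      + √(R / m) * sampleMean x k ^ 2) := by
  have sum_drawn : ∑ r, (drawn x (π r) 0 k + drawn x (π r) 1 k)
      = ∑ r, sumTerm x (π r) k + R * (2 * sampleMean x k) := by
    simp [sumTerm, Finset.sum_sub_distrib]
  rw [lambdaHat, linStat, sum_drawn, ← inv_sqrt_mul_mul m R]
  ring

lemma uStat_zero (x : Sample n m) (π : Draws n R) (k : Fin m) :
    uStat x π k 0 = uStat x π k (sampleMean x k) + lambdaHat x π k := by
  have sum_eq : ∑ r, (drawn x (π r) 0 k - 0) * (sampleVar x k k)⁻¹ * (drawn x (π r) 1 k - 0)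
      = ∑ r, pairTerm x (π r) k + sampleMean x k * (sampleVar x k k)⁻¹ *
        ∑ r, (drawn x (π r) 0 k + drawn x (π r) 1 k)
        - ∑ _r : Fin R, (sampleVar x k k)⁻¹ * sampleMean x k ^ 2 := by
    rw [Finset.mul_sum, ← Finset.sum_add_distrib, ← Finset.sum_sub_distrib]
    refine Finset.sum_congr rfl fun r _ => ?_
    rw [pairTerm]
    ring
  rw [uStat_sampleMean, lambdaHat, uStat, sum_eq, ← inv_sqrt_mul_mul m R, Finset.sum_const,
    Finset.card_univ, Fintype.card_fin, nsmul_eq_mul]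
  ring

lemma testStat_eq (x : Sample n m) (π : Draws n R) :
    testStat x π = ⨆ k, (uStat x π k (sampleMean x k) + shift x π k) := by
  refine iSup_congr fun k => ?_
  rw [uStat_zero, shift]
  split_ifs with hneg
  · rw [max_eq_right hneg.le]
    ring
  · rw [max_eq_left (not_lt.1 hneg), lambdaHat_eq]
    ring

lemma testStat_le_iff [NeZero m] (x : Sample n m) (π : Draws n R) (c : ℝ) :
    testStat x π ≤ c ↔ ∀ k, uStat x π k (sampleMean x k) + shift x π k ≤ c := by
  rw [testStat_eq]
  exact ciSup_le_iff (Set.finite_range _).bddAbove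

lemma shift_eq (hR : 0 < R) (x : Sample n m) (π : Draws n R) (k : Fin m) :
    shift x π k = (sampleVar x k k)⁻¹ * (((R : ℝ) ^ (1 / 4 : ℝ))⁻¹ * posScaledMean R x k *
      linStat x π k + (√m)⁻¹ * posScaledMean R x k ^ 2) := by
  have scale_pos : 0 < (R : ℝ) ^ (1 / 4 : ℝ) := by positivity
  have posScaledMean_eq :
      posScaledMean R x k = (R : ℝ) ^ (1 / 4 : ℝ) * max (sampleMean x k) 0 := by
    rw [posScaledMean, mul_max_of_nonneg _ _ scale_pos.le, mul_zero]
  rw [posScaledMean_eq, shift, Real.sqrt_div (Nat.cast_nonneg R), sqrt_eq_rpow_quarter_sq]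
  field_simp

lemma integral_linStat (hn : 2 ≤ n) (x : Sample n m) (k : Fin m) :
    ∫ π : Draws n R, linStat x π k ∂drawLaw n R = 0 := by
  have integral_draw (r : Fin R) : ∫ π : Draws n R, sumTerm x (π r) k ∂drawLaw n R = 0 := by
    rw [drawLaw_eq_pi_permLaw, integral_comp_eval (μ := fun _ : Fin R => permLaw n) (i := r)
      (f := fun σ => sumTerm x σ k) (measurable_of_finite _).aestronglyMeasurable]
    exact integral_sumTerm hn x k
  simp only [linStat, integral_const_mul, integral_finsetSum _ fun _ _ => Integrable.of_finite,
    integral_draw, Finset.sum_const_zero, mul_zero]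

lemma variance_linStat_le (hn : 2 ≤ n) (x : Sample n m) (k : Fin m) :
    Var[fun π : Draws n R => linStat x π k; drawLaw n R] ≤ 4 * sampleVar x k k := by
  have variance_sumTerm_le : Var[fun σ => sumTerm x σ k; permLaw n] ≤ 4 * sampleVar x k k := by
    rw [variance_of_integral_eq_zero (measurable_of_finite _).aemeasurable
      (integral_sumTerm hn x k)]
    exact integral_sumTerm_sq_le hn x k
  have linStat_eq : (fun π : Draws n R => linStat x π k)
      = fun π => (√(m * R))⁻¹ * (∑ r, fun π : Draws n R => sumTerm x (π r) k) π := by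
    simp only [linStat, Finset.sum_apply]
  have weight_le_one : ((m : ℝ) * R)⁻¹ * R ≤ 1 :=
    inv_mul_le_one_of_le₀ (le_mul_of_one_le_left (Nat.cast_nonneg R)
      (Nat.one_le_cast.2 (Fin.pos k))) (by positivity)
  calc Var[fun π : Draws n R => linStat x π k; drawLaw n R]
      = ((m : ℝ) * R)⁻¹ * R * Var[fun σ => sumTerm x σ k; permLaw n] := by
        rw [linStat_eq, variance_const_mul, drawLaw_eq_pi_permLaw,
          variance_sum_pi (μ := fun _ : Fin R => permLaw n) (X := fun _ σ => sumTerm x σ k)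
            fun _ => .of_discrete,
          Finset.sum_const, Finset.card_univ, Fintype.card_fin, nsmul_eq_mul, inv_pow,
          Real.sq_sqrt (by positivity), mul_assoc]
    _ ≤ Var[fun σ => sumTerm x σ k; permLaw n] :=
        mul_le_of_le_one_left (variance_nonneg _ _) weight_le_one
    _ ≤ 4 * sampleVar x k k := variance_sumTerm_le

lemma measureReal_mul_linStat_le (hn : 2 ≤ n) (x : Sample n m) (k : Fin m) (b : ℝ) {ε : ℝ}
    (hε : 0 < ε) :
    (drawLaw n R).real {π | ε ≤ |b * linStat x π k|} ≤ b ^ 2 * (4 * sampleVar x k k) / ε ^ 2 := by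
  have chebyshev := meas_ge_le_variance_div_sq (μ := drawLaw n R)
    (X := fun π : Draws n R => b * linStat x π k) .of_discrete hε
  simp only [integral_const_mul, integral_linStat hn, mul_zero, sub_zero, variance_const_mul]
    at chebyshev
  refine (ENNReal.toReal_le_of_le_ofReal
    (div_nonneg (mul_nonneg (sq_nonneg b) (variance_nonneg _ _)) (sq_nonneg ε)) chebyshev).trans ?_
  gcongr
  exact variance_linStat_le hn x k

end LinearStatistic

section Shift

variable {m : ℕ} {δ M : ℝ} {S : Matrix (Fin m) (Fin m) ℝ} {N R : ℕ → ℕ} {x : ∀ j, Sample (N j) m}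
  {k : Fin m}

lemma tendsto_rpow_quarter (hR : Tendsto R atTop atTop) :
    Tendsto (fun j => (R j : ℝ) ^ (1 / 4 : ℝ)) atTop atTop :=
  (tendsto_rpow_atTop (by norm_num)).comp (tendsto_natCast_atTop_atTop.comp hR)

namespace RegularArray

lemma tendsto_mul_linStat (h : RegularArray δ M S N R x) (k : Fin m) {b : ℕ → ℝ}
    (hb : Tendsto b atTop (𝓝 0)) {ε : ℝ} (hε : 0 < ε) :
    Tendsto (fun j => (drawLaw (N j) (R j)).real {π | ε ≤ |b j * linStat (x j) π k|}) atTop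
      (𝓝 0) := by
  have bound_tendsto := ((hb.pow 2).mul ((h.var k k).const_mul 4)).div_const (ε ^ 2)
  rw [zero_pow two_ne_zero, zero_mul, zero_div] at bound_tendsto
  refine squeeze_zero' (.of_forall fun _ => measureReal_nonneg) ?_ bound_tendsto
  filter_upwards [h.size.eventually_ge_atTop 2] with j hj
  exact measureReal_mul_linStat_le hj (x j) k (b j) hε

lemma tendsto_shift (h : RegularArray δ M S N R x) (hS : S k k ≠ 0) {y : ℝ}
    (hy : Tendsto (fun j => posScaledMean (R j) (x j) k) atTop (𝓝 y)) {ε : ℝ} (hε : 0 < ε) :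
    Tendsto (fun j => (drawLaw (N j) (R j)).real
      {π | ε ≤ |shift (x j) π k - (S k k)⁻¹ * ((√m)⁻¹ * y ^ 2)|}) atTop (𝓝 0) := by
  set slope : ℕ → ℝ := fun j => (sampleVar (x j) k k)⁻¹ *
    (((R j : ℝ) ^ (1 / 4 : ℝ))⁻¹ * posScaledMean (R j) (x j) k)
  set center : ℕ → ℝ := fun j => (sampleVar (x j) k k)⁻¹ *
    ((√m)⁻¹ * posScaledMean (R j) (x j) k ^ 2)
  have inv_var_tendsto := (h.var k k).inv₀ hS
  have slope_tendsto : Tendsto slope atTop (𝓝 0) := by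
    have product_tendsto := inv_var_tendsto.mul
      ((tendsto_inv_atTop_zero.comp (tendsto_rpow_quarter h.draws)).mul hy)
    rw [zero_mul, mul_zero] at product_tendsto
    exact product_tendsto
  have center_tendsto : Tendsto center atTop (𝓝 ((S k k)⁻¹ * ((√m)⁻¹ * y ^ 2))) :=
    inv_var_tendsto.mul ((hy.pow 2).const_mul _)
  refine squeeze_zero' (.of_forall fun _ => measureReal_nonneg) ?_
    (h.tendsto_mul_linStat k slope_tendsto (half_pos hε))
  filter_upwards [Metric.tendsto_nhds.1 center_tendsto (ε / 2) (half_pos hε),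
    h.draws.eventually_gt_atTop 0] with j center_close hRj
  refine measureReal_mono fun π hπ => ?_
  simp only [Set.mem_ofPred_eq] at hπ ⊢
  rw [Real.dist_eq] at center_close
  have shift_sub : shift (x j) π k - (S k k)⁻¹ * ((√m)⁻¹ * y ^ 2) = slope j * linStat (x j) π k +
      (center j - (S k k)⁻¹ * ((√m)⁻¹ * y ^ 2)) := by
    simp only [shift_eq hRj, slope, center]
    ring
  have := hπ.trans (shift_sub ▸ abs_add_le _ _)
  linarith

lemma tendsto_shift_atTop (h : RegularArray δ M S N R x) (hS : 0 < S k k)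
    (hy : Tendsto (fun j => posScaledMean (R j) (x j) k) atTop atTop) (B : ℝ) :
    Tendsto (fun j => (drawLaw (N j) (R j)).real {π | shift (x j) π k ≤ B}) atTop (𝓝 0) := by
  have sqrt_pos : 0 < √(m : ℝ) := Real.sqrt_pos.2 (Nat.cast_pos.2 (Fin.pos k))
  have lower_bound_tendsto : Tendsto (fun j => (sampleVar (x j) k k)⁻¹ *
      (posScaledMean (R j) (x j) k * ((√m)⁻¹ * posScaledMean (R j) (x j) k + -1))) atTop atTop :=
    ((h.var k k).inv₀ hS.ne').pos_mul_atTop (inv_pos.2 hS) (hy.atTop_mul_atTop₀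
      (tendsto_atTop_add_const_right _ _ (hy.const_mul_atTop (inv_pos.2 sqrt_pos))))
  refine squeeze_zero' (.of_forall fun _ => measureReal_nonneg) ?_ (h.tendsto_mul_linStat k
    (tendsto_inv_atTop_zero.comp (tendsto_rpow_quarter h.draws)) one_pos)
  filter_upwards [lower_bound_tendsto.eventually_gt_atTop B, h.draws.eventually_gt_atTop 0,
    (h.var k k).eventually_const_lt hS] with j hj hRj var_pos
  refine measureReal_mono fun π hπ => ?_
  simp only [Set.mem_ofPred_eq, Function.comp_apply] at hπ ⊢
  by_contra! hlt
  have shift_ge : (sampleVar (x j) k k)⁻¹ *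
      (posScaledMean (R j) (x j) k * ((√m)⁻¹ * posScaledMean (R j) (x j) k + -1))
        ≤ shift (x j) π k := by
    rw [shift_eq hRj]
    refine mul_le_mul_of_nonneg_left ?_ (inv_pos.2 var_pos).le
    have y_nonneg : 0 ≤ posScaledMean (R j) (x j) k := le_max_right _ _
    have linear_ge := mul_le_mul_of_nonneg_left (abs_lt.1 hlt).1.le y_nonneg
    linarith
  exact (hj.trans_le shift_ge).not_ge hπ

end RegularArray

end Shift

section Perturbation

variable {ι : Type*}

lemma measureReal_add_le_le [Fintype ι] {Ω : Type*} [MeasurableSpace Ω] {μ : Measure Ω}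
    [IsFiniteMeasure μ] (W T : Ω → ι → ℝ) (a s : ι → ℝ) (ε : ℝ) :
    μ.real {ω | ∀ k, W ω k + T ω k ≤ a k}
      ≤ μ.real {ω | ∀ k, W ω k ≤ a k - s k + ε} + ∑ k, μ.real {ω | ε ≤ |T ω k - s k|} := by
  have subset_union : {ω | ∀ k, W ω k + T ω k ≤ a k} ⊆
      {ω | ∀ k, W ω k ≤ a k - s k + ε} ∪ ⋃ k, {ω | ε ≤ |T ω k - s k|} := by
    intro ω hω
    by_cases close : ∀ k, |T ω k - s k| < ε
    · exact .inl fun k => by linarith [hω k, (abs_lt.1 (close k)).1]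
    · exact .inr (by simpa using close)
  exact (measureReal_mono subset_union).trans ((measureReal_union_le _ _).trans
    (add_le_add_right (measureReal_iUnion_fintype_le _) _))

lemma measureReal_le_le_add_le [Fintype ι] {Ω : Type*} [MeasurableSpace Ω] {μ : Measure Ω}
    [IsFiniteMeasure μ] (W T : Ω → ι → ℝ) (a s : ι → ℝ) (ε : ℝ) :
    μ.real {ω | ∀ k, W ω k ≤ a k - s k - ε}
      ≤ μ.real {ω | ∀ k, W ω k + T ω k ≤ a k} + ∑ k, μ.real {ω | ε ≤ |T ω k - s k|} := by
  have cancel (k : ι) : a k - s k - ε + s k + ε = a k := by ring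
  have := measureReal_add_le_le (μ := μ) (W + T) (-T) (fun k => a k - s k - ε) (-s) ε
  simpa [neg_add_eq_sub, abs_sub_comm, cancel] using this

lemma tendsto_measureReal_add_le [Finite ι] {β : Type*} {l : Filter β} {Ω : β → Type*}
    [∀ j, MeasurableSpace (Ω j)] {μ : ∀ j, Measure (Ω j)} [∀ j, IsFiniteMeasure (μ j)]
    {W T : ∀ j, Ω j → ι → ℝ} {G : (ι → ℝ) → ℝ} (hG : Continuous G)
    (hW : ∀ a, Tendsto (fun j => (μ j).real {ω | ∀ k, W j ω k ≤ a k}) l (𝓝 (G a)))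
    {s : ι → ℝ}
    (hT : ∀ k, ∀ ε : ℝ, 0 < ε → Tendsto (fun j => (μ j).real {ω | ε ≤ |T j ω k - s k|}) l (𝓝 0))
    {c : β → ℝ} {q : ℝ} (hc : Tendsto c l (𝓝 q)) :
    Tendsto (fun j => (μ j).real {ω | ∀ k, W j ω k + T j ω k ≤ c j}) l
      (𝓝 (G fun k => q - s k)) := by
  have := Fintype.ofFinite ι
  have tendsto_bad (ε : ℝ) (hε : 0 < ε) :
      Tendsto (fun j => ∑ k, (μ j).real {ω | ε ≤ |T j ω k - s k|}) l (𝓝 0) := by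
    simpa using tendsto_finsetSum Finset.univ fun k _ => hT k ε hε
  refine tendsto_order.2 ⟨fun a ha => ?_, fun b hb => ?_⟩
  · have lower_continuous : Continuous fun ε : ℝ => G fun k => q - ε - s k - ε :=
      hG.comp (by fun_prop)
    obtain ⟨ε, hε, hGε⟩ := ((lower_continuous.tendsto 0).eventually_const_lt (u := a)
      (by simpa using ha)).exists_gt
    have lower_tendsto := (hW fun k => q - ε - s k - ε).sub (tendsto_bad ε hε)
    rw [sub_zero] at lower_tendsto
    filter_upwards [lower_tendsto.eventually_const_lt hGε,
      hc.eventually_const_lt (sub_lt_self q hε)] with j hj hcj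
    have perturbed := measureReal_le_le_add_le (μ := μ j) (W j) (T j) (fun _ => q - ε) s ε
    have mono : (μ j).real {ω | ∀ k, W j ω k + T j ω k ≤ q - ε}
        ≤ (μ j).real {ω | ∀ k, W j ω k + T j ω k ≤ c j} :=
      measureReal_mono fun ω hω k => (hω k).trans hcj.le
    linarith
  · have upper_continuous : Continuous fun ε : ℝ => G fun k => q + ε - s k + ε :=
      hG.comp (by fun_prop)
    obtain ⟨ε, hε, hGε⟩ := ((upper_continuous.tendsto 0).eventually_lt_const (u := b)
      (by simpa using hb)).exists_gt
    have upper_tendsto := (hW fun k => q + ε - s k + ε).add (tendsto_bad ε hε)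
    rw [add_zero] at upper_tendsto
    filter_upwards [upper_tendsto.eventually_lt_const hGε,
      hc.eventually_lt_const (lt_add_of_pos_right q hε)] with j hj hcj
    calc (μ j).real {ω | ∀ k, W j ω k + T j ω k ≤ c j}
        ≤ (μ j).real {ω | ∀ k, W j ω k + T j ω k ≤ q + ε} :=
          measureReal_mono fun ω hω k => (hω k).trans hcj.le
      _ ≤ _ := measureReal_add_le_le (W j) (T j) (fun _ => q + ε) s ε
      _ < b := hj

end Perturbation

section ConditionalRejection

variable {m : ℕ} [NeZero m]

/-- The rejection probability when the data are held fixed. -/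
def condRejection {n m : ℕ} (R : ℕ) (α : ℝ) (x : Sample n m) : ℝ :=
  (drawLaw n R).real {π | critVal R α x < testStat x π}

lemma condRejection_eq {n : ℕ} (R : ℕ) (α : ℝ) (x : Sample n m) :
    condRejection R α x = 1 - (drawLaw n R).real
      {π | ∀ k, centredVec x π k + shift x π k ≤ critVal R α x} := by
  rw [condRejection, ← probReal_compl_eq_one_sub (Set.toFinite _).measurableSet]
  congr 1 with π
  exact not_le.symm.trans (testStat_le_iff x π _).not

variable {δ M : ℝ} {S : Matrix (Fin m) (Fin m) ℝ} {N R : ℕ → ℕ} {x : ∀ j, Sample (N j) m}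

/-- The limit of the shifts of the test statistic if the positive parts of the scaled sample means
tend to `y`. -/
def limitShift {m : ℕ} (S : Matrix (Fin m) (Fin m) ℝ) (y : Fin m → ℝ) (k : Fin m) : ℝ :=
  (S k k)⁻¹ * ((√m)⁻¹ * y k ^ 2)

namespace RegularArray

lemma tendsto_condRejection (h : RegularArray δ M S N R x) (hδ : 0 < δ) (hS : S.PosDef)
    {α q : ℝ} (hα0 : 0 < α) (hα1 : α < 1)
    (hq : jointCdf (limitLaw S : Measure (EuclideanSpace ℝ (Fin m))) (fun _ => q) = 1 - α)
    {y : Fin m → ℝ} (hy : ∀ k, Tendsto (fun j => posScaledMean (R j) (x j) k) atTop (𝓝 (y k))) :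
    Tendsto (fun j => condRejection (R j) α (x j)) atTop
      (𝓝 (1 - jointCdf (limitLaw S : Measure (EuclideanSpace ℝ (Fin m)))
        fun k => q - limitShift S y k)) := by
  have law_tendsto := h.tendsto_centredLaw hδ hS
  simp only [condRejection_eq]
  refine (tendsto_measureReal_add_le (μ := fun j => drawLaw (N j) (R j))
    (W := fun j π k => centredVec (x j) π k) (T := fun j π k => shift (x j) π k)
    (continuous_jointCdf (limitLaw_eval_eq hS)) (fun a => ?_)
    (fun k ε hε => h.tendsto_shift hS.diag_pos.ne' (hy k) hε)
    (tendsto_critVal hS hα0 hα1 hq law_tendsto)).const_sub 1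
  exact (tendsto_jointCdf law_tendsto (limitLaw_eval_eq hS) a).congr fun j =>
    (measureReal_centredVec_mem (R j) (x j) (measurableSet_orthant a)).symm

lemma tendsto_condRejection_one (h : RegularArray δ M S N R x) (hδ : 0 < δ) (hS : S.PosDef)
    {α : ℝ} (hα0 : 0 < α) (hα1 : α < 1) {k : Fin m}
    (hk : Tendsto (fun j => posScaledMean (R j) (x j) k) atTop atTop) :
    Tendsto (fun j => condRejection (R j) α (x j)) atTop (𝓝 1) := by
  have law_tendsto := h.tendsto_centredLaw hδ hS
  obtain ⟨q, hq⟩ := exists_jointCdf_const_eq (p := 1 - α) (limitLaw_eval_eq hS) (by linarith)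
    (by linarith)
  have critVal_tendsto := tendsto_critVal hS hα0 hα1 hq law_tendsto
  suffices acceptance_tendsto : Tendsto (fun j => (drawLaw (N j) (R j)).real
      {π | ∀ k, centredVec (x j) π k + shift (x j) π k ≤ critVal (R j) α (x j)}) atTop (𝓝 0) by
    simpa [condRejection_eq] using acceptance_tendsto.const_sub 1
  refine tendsto_order.2 ⟨fun a ha => .of_forall fun j => ha.trans_le measureReal_nonneg,
    fun b hb => ?_⟩
  obtain ⟨B, hB⟩ := ((tendsto_measureReal_le_atBot
    (μ := (limitLaw S : Measure (EuclideanSpace ℝ (Fin m)))) (f := fun w => w k)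
    (by fun_prop)).eventually_lt_const hb).exists
  have bound_tendsto := (tendsto_measureReal_eval_le law_tendsto (limitLaw_eval_eq hS) k B).add
    (h.tendsto_shift_atTop hS.diag_pos hk (q + 1 - B))
  rw [add_zero] at bound_tendsto
  filter_upwards [bound_tendsto.eventually_lt_const hB,
    critVal_tendsto.eventually_lt_const (lt_add_one q)] with j bound_lt critVal_lt
  rw [← measureReal_centredVec_mem (R j) (x j)
    (measurableSet_le (by fun_prop) measurable_const)] at bound_lt
  refine ((measureReal_mono fun π hπ => ?_).trans (measureReal_union_le _ _)).trans_lt bound_lt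
  by_contra! hout
  simp only [Set.mem_union, Set.mem_ofPred_eq, not_or, not_le] at hout hπ
  linarith [hπ k]

end RegularArray

end ConditionalRejection

section ProbFilter

variable {Ω : ℕ → Type*} [∀ n, MeasurableSpace (Ω n)] {μ : ∀ n, Measure (Ω n)}
  [∀ n, IsFiniteMeasure (μ n)]

/-- The filter of the events whose complements have vanishing measure along a sequence of measure
spaces. Convergence in probability is convergence along this filter. -/
def probFilter {Ω : ℕ → Type*} [∀ n, MeasurableSpace (Ω n)] (μ : ∀ n, Measure (Ω n))
    [∀ n, IsFiniteMeasure (μ n)] : Filter (Σ n, Ω n) where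
  sets := {U | Tendsto (fun n => (μ n).real {ω | ⟨n, ω⟩ ∉ U}) atTop (𝓝 0)}
  univ_sets := by simp
  sets_of_superset hU hUV := by
    refine squeeze_zero (fun _ => measureReal_nonneg) (fun n => ?_) hU
    exact measureReal_mono fun ω hω hω' => hω (hUV hω')
  inter_sets hU hV := by
    refine squeeze_zero (fun _ => measureReal_nonneg) (fun n => ?_)
      (by simpa only [add_zero] using Tendsto.add hU hV)
    exact (measureReal_mono fun ω hω => not_and_or.1 hω).trans (measureReal_union_le _ _)

lemma mem_probFilter {U : Set (Σ n, Ω n)} :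
    U ∈ probFilter μ ↔ Tendsto (fun n => (μ n).real {ω | ⟨n, ω⟩ ∉ U}) atTop (𝓝 0) := Iff.rfl

lemma tendsto_fst_probFilter : Tendsto Sigma.fst (probFilter μ) atTop := by
  intro s hs
  rw [mem_map, mem_probFilter]
  refine tendsto_const_nhds.congr' ?_
  filter_upwards [hs] with n hn
  simp [hn]

lemma tendsto_probFilter_iff_convergesInProb {X : ∀ n, Ω n → ℝ} {c : ℝ} :
    Tendsto (fun p : Σ n, Ω n => X p.1 p.2) (probFilter μ) (𝓝 c) ↔ ConvergesInProb μ X c := by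
  simp only [Metric.tendsto_nhds, Filter.Eventually, mem_probFilter, ConvergesInProb,
    Set.mem_ofPred_eq, not_lt, Real.dist_eq, gt_iff_lt]

lemma tendsto_probFilter_of_boundedInProb {E F : Type*} [Norm E] {b : ∀ n, Ω n → E}
    (hb : BoundedInProb μ b) {f : (Σ n, Ω n) → F} {l : Filter F}
    (hf : ∀ M : ℝ, Tendsto f (probFilter μ ⊓ 𝓟 {p | ‖b p.1 p.2‖ ≤ M}) l) :
    Tendsto f (probFilter μ) l := by
  intro s hs
  rw [mem_map, mem_probFilter]
  refine tendsto_order.2 ⟨fun a ha => .of_forall fun n => ha.trans_le measureReal_nonneg,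
    fun ε hε => ?_⟩
  obtain ⟨M, hM⟩ := hb (ε / 2) (half_pos hε)
  have exception_tendsto := mem_probFilter.1 (eventually_inf_principal.1 (hf M hs))
  filter_upwards [hM, exception_tendsto.eventually_lt_const (half_pos hε)] with n large exception
  calc (μ n).real {ω | ⟨n, ω⟩ ∉ f ⁻¹' s}
      ≤ (μ n).real ({ω | M < ‖b n ω‖} ∪ {ω | ¬(‖b n ω‖ ≤ M → f ⟨n, ω⟩ ∈ s)}) :=
        measureReal_mono fun ω hω => (lt_or_ge M ‖b n ω‖).imp_right fun hle himp => hω (himp hle)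
    _ ≤ _ := measureReal_union_le _ _
    _ < ε / 2 + ε / 2 := add_lt_add_of_le_of_lt large exception
    _ = ε := add_halves ε

lemma tendsto_probFilter_mul_of_boundedInProb {a : ℕ → ℝ} (ha : Tendsto a atTop (𝓝 0))
    {X : ∀ n, Ω n → ℝ} (hX : BoundedInProb μ X) :
    Tendsto (fun p : Σ n, Ω n => a p.1 * X p.1 p.2) (probFilter μ) (𝓝 0) :=
  tendsto_probFilter_of_boundedInProb hX fun M =>
    ((ha.comp tendsto_fst_probFilter).mono_left inf_le_left).zero_mul_isBoundedUnder_le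
      ⟨M, eventually_map.2 (eventually_inf_principal.2 (.of_forall fun _ => id))⟩

end ProbFilter

section BoundedConvergence

lemma abs_integral_sub_le {Ω : Type*} [MeasurableSpace Ω] {μ : Measure Ω} [IsProbabilityMeasure μ]
    {f : Ω → ℝ} (hf : Measurable f) (hf01 : ∀ ω, f ω ∈ Set.Icc (0 : ℝ) 1) {c : ℝ}
    (hc : c ∈ Set.Icc (0 : ℝ) 1) {ε : ℝ} (hε : 0 ≤ ε) :
    |∫ ω, f ω ∂μ - c| ≤ ε + μ.real {ω | ε ≤ |f ω - c|} := by
  set far : Set Ω := {ω | ε ≤ |f ω - c|}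
  have measurableSet_far : MeasurableSet far :=
    measurableSet_le measurable_const (hf.sub_const c).norm
  have integrable_f : Integrable f μ := .of_mem_Icc 0 1 hf.aemeasurable (.of_forall hf01)
  have integrable_indicator : Integrable (far.indicator (1 : Ω → ℝ)) μ :=
    (integrable_const (1 : ℝ)).indicator measurableSet_far
  have pointwise (ω : Ω) : |f ω - c| ≤ ε + far.indicator 1 ω := by
    by_cases hω : ω ∈ far
    · rw [Set.indicator_of_mem hω, Pi.one_apply]
      exact (Real.dist_le_of_mem_Icc_01 (hf01 ω) hc).trans (le_add_of_nonneg_left hε)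
    · rw [Set.indicator_of_notMem hω, add_zero]
      exact (not_le.1 hω).le
  calc |∫ ω, f ω ∂μ - c| = |∫ ω, (f ω - c) ∂μ| := by
        simp [integral_sub integrable_f (integrable_const c)]
    _ ≤ ∫ ω, |f ω - c| ∂μ := abs_integral_le_integral_abs
    _ ≤ ∫ ω, (ε + far.indicator 1 ω) ∂μ :=
        integral_mono (integrable_f.sub (integrable_const c)).abs
          ((integrable_const ε).add integrable_indicator) pointwise
    _ = ε + μ.real far := by
        rw [integral_add (integrable_const ε) integrable_indicator,
          integral_indicator_one measurableSet_far, integral_const, probReal_univ, one_smul]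

lemma tendsto_integral_of_tendsto_probFilter {Ω : ℕ → Type*} [∀ n, MeasurableSpace (Ω n)]
    {μ : ∀ n, Measure (Ω n)} [∀ n, IsProbabilityMeasure (μ n)] {f : ∀ n, Ω n → ℝ}
    (hf : ∀ n, Measurable (f n)) (hf01 : ∀ n ω, f n ω ∈ Set.Icc (0 : ℝ) 1) {c : ℝ}
    (hc : c ∈ Set.Icc (0 : ℝ) 1)
    (hlim : Tendsto (fun p : Σ n, Ω n => f p.1 p.2) (probFilter μ) (𝓝 c)) :
    Tendsto (fun n => ∫ ω, f n ω ∂μ n) atTop (𝓝 c) := by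
  refine Metric.tendsto_nhds.2 fun ε hε => ?_
  have tendsto_far := tendsto_probFilter_iff_convergesInProb.1 hlim (ε / 2) (half_pos hε)
  filter_upwards [tendsto_far.eventually_lt_const (half_pos hε)] with n hn
  calc |∫ ω, f n ω ∂μ n - c|
      ≤ ε / 2 + (μ n).real {ω | ε / 2 ≤ |f n ω - c|} :=
        abs_integral_sub_le (hf n) (hf01 n) hc (half_pos hε).le
    _ < ε / 2 + ε / 2 := by gcongr
    _ = ε := add_halves ε

end BoundedConvergence

section Measurability

variable {n m R : ℕ}

lemma measurable_sampleMean (k : Fin m) : Measurable fun x : Sample n m => sampleMean x k := by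
  unfold sampleMean
  fun_prop

lemma measurable_sampleVar (k l : Fin m) : Measurable fun x : Sample n m => sampleVar x k l := by
  have := measurable_sampleMean (n := n) (m := m)
  simp only [sampleVar, Matrix.of_apply]
  fun_prop

lemma measurable_drawn (σ : Equiv.Perm (Fin n)) (j : ℕ) (k : Fin m) :
    Measurable fun x : Sample n m => drawn x σ j k := by
  unfold drawn
  split_ifs
  · fun_prop
  · exact measurable_const

lemma measurable_uStat (π : Draws n R) (k : Fin m) {a : Sample n m → ℝ} (ha : Measurable a) :
    Measurable fun x : Sample n m => uStat x π k (a x) := by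
  have := measurable_drawn (n := n) (m := m)
  have := measurable_sampleVar (n := n) (m := m)
  unfold uStat
  fun_prop

lemma measurable_lambdaHat (π : Draws n R) (k : Fin m) :
    Measurable fun x : Sample n m => lambdaHat x π k := by
  have := measurable_drawn (n := n) (m := m)
  have := measurable_sampleVar (n := n) (m := m)
  have := measurable_sampleMean (n := n) (m := m)
  unfold lambdaHat
  fun_prop

lemma measurable_testStat (π : Draws n R) : Measurable fun x : Sample n m => testStat x π :=
  .iSup fun k => (measurable_uStat π k measurable_const).sub ((measurable_lambdaHat π k).mul
    (.ite (measurableSet_lt (measurable_sampleMean k) measurable_const)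
      measurable_const measurable_const))

lemma measurable_centredStat (π : Draws n R) :
    Measurable fun x : Sample n m => centredStat x π :=
  .iSup fun k => measurable_uStat π k (measurable_sampleMean k)

lemma measurableSet_fst_mem_snd {X Y : Type*} [MeasurableSpace X] [MeasurableSpace Y]
    [Countable Y] [MeasurableSingletonClass Y] {A : Y → Set X} (hA : ∀ y, MeasurableSet (A y)) :
    MeasurableSet {p : X × Y | p.1 ∈ A p.2} :=
  measurableSet_setOfPred.2 (measurable_from_prod_countable_left fun y => (hA y).mem)

lemma measurable_drawLaw_real {A : Draws n R → Set (Sample n m)} (hA : ∀ π, MeasurableSet (A π)) :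
    Measurable fun x : Sample n m => (drawLaw n R).real {π | x ∈ A π} :=
  (measurable_measure_prodMk_left (measurableSet_fst_mem_snd hA)).ennreal_toReal

variable {α : ℝ}

lemma measurable_critVal (hα0 : 0 < α) (hα1 : α < 1) :
    Measurable fun x : Sample n m => critVal R α x := by
  refine measurable_of_Iic fun c => ?_
  simp only [Set.preimage, Set.mem_Iic, critVal_le_iff hα0 hα1]
  exact measurableSet_le measurable_const
    (measurable_drawLaw_real fun π => measurableSet_le (measurable_centredStat π) measurable_const)

lemma measurableSet_critVal_lt_testStat (hα0 : 0 < α) (hα1 : α < 1) (π : Draws n R) :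
    MeasurableSet {x : Sample n m | critVal R α x < testStat x π} :=
  measurableSet_lt (measurable_critVal hα0 hα1) (measurable_testStat π)

lemma measurable_condRejection (hα0 : 0 < α) (hα1 : α < 1) :
    Measurable fun x : Sample n m => condRejection R α x :=
  measurable_drawLaw_real (measurableSet_critVal_lt_testStat hα0 hα1)

lemma integral_test (x : Sample n m) :
    ∫ π : Draws n R, test α x π ∂drawLaw n R = condRejection R α x :=
  integral_indicator_one (Set.toFinite {π : Draws n R | critVal R α x < testStat x π}).measurableSet

lemma rejectionProb_eq (hα0 : 0 < α) (hα1 : α < 1) (P : DGP n m) :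
    rejectionProb P R α = ∫ x, condRejection R α x ∂P.law := by
  have measurable_test : Measurable fun p : Sample n m × Draws n R => test α p.1 p.2 :=
    .ite (measurableSet_fst_mem_snd (measurableSet_critVal_lt_testStat hα0 hα1))
      measurable_const measurable_const
  have test_mem (p : Sample n m × Draws n R) : test α p.1 p.2 ∈ Set.Icc (0 : ℝ) 1 := by
    unfold test
    split_ifs <;> simp
  rw [rejectionProb, integral_prod _ (.of_mem_Icc 0 1 measurable_test.aemeasurable
    (.of_forall test_mem))]
  simp only [integral_test]

end Measurability

section SampleFilter

variable {m : ℕ} {R : ℕ → ℕ} {S : Matrix (Fin m) (Fin m) ℝ} {d : Fin m → EReal}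

/-- The filter of samples of growing size whose variance matrix converges to `S` and whose scaled
means `R^{1/4} X̄` converge to `d`. -/
def sampleFilter (R : ℕ → ℕ) (S : Matrix (Fin m) (Fin m) ℝ) (d : Fin m → EReal) :
    Filter (Σ n, Sample n m) :=
  comap (fun p => (p.1, fun k l => sampleVar p.2 k l,
      fun k => (((R p.1 : ℝ) ^ (1 / 4 : ℝ) * sampleMean p.2 k : ℝ) : EReal)))
    (atTop ×ˢ 𝓝 (fun k l => S k l) ×ˢ 𝓝 d)

instance : (sampleFilter R S d).IsCountablyGenerated :=
  comap.isCountablyGenerated _ _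

lemma tendsto_sampleFilter_iff {ι : Type*} {l : Filter ι} {u : ι → Σ n, Sample n m} :
    Tendsto u l (sampleFilter R S d) ↔ Tendsto (fun i => (u i).1) l atTop ∧
      (∀ k k', Tendsto (fun i => sampleVar (u i).2 k k') l (𝓝 (S k k'))) ∧
      ∀ k, Tendsto (fun i => (((R (u i).1 : ℝ) ^ (1 / 4 : ℝ) * sampleMean (u i).2 k : ℝ) : EReal)) l
        (𝓝 (d k)) := by
  simp only [sampleFilter, tendsto_comap_iff, tendsto_prod_iff', tendsto_pi_nhds,
    Function.comp_def]

end SampleFilter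

section ScaledMean

lemma tendsto_coe_add_zero {ι : Type*} {l : Filter ι} {f g : ι → ℝ} {d : EReal}
    (hf : Tendsto (fun i => (f i : EReal)) l (𝓝 d)) (hg : Tendsto g l (𝓝 0)) :
    Tendsto (fun i => ((f i + g i : ℝ) : EReal)) l (𝓝 d) := by
  have coe_tendsto : Tendsto (fun i => (g i : EReal)) l (𝓝 0) := EReal.tendsto_coe.2 hg
  have add_continuousAt : ContinuousAt (fun p : EReal × EReal => p.1 + p.2) (d, 0) :=
    EReal.continuousAt_add (.inr EReal.zero_ne_bot) (.inr EReal.zero_ne_top)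
  simpa [Function.comp_def] using add_continuousAt.tendsto.comp (hf.prodMk_nhds coe_tendsto)

lemma tendsto_max_toReal {ι : Type*} {l : Filter ι} {f : ι → ℝ} {d : EReal}
    (hf : Tendsto (fun j => (f j : EReal)) l (𝓝 d)) (hd : d ≠ ⊤) :
    Tendsto (fun j => max (f j) 0) l (𝓝 (max d 0).toReal) := by
  have max_ne_top : max d 0 ≠ ⊤ := (max_lt (lt_top_iff_ne_top.2 hd) EReal.zero_lt_top).ne
  have max_ne_bot : max d 0 ≠ ⊥ := (EReal.bot_lt_zero.trans_le (le_max_right d 0)).ne'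
  refine ((EReal.tendsto_toReal max_ne_top max_ne_bot).comp
    (hf.max tendsto_const_nhds)).congr fun j => ?_
  rw [Function.comp_apply, ← EReal.coe_zero, ← EReal.coe_strictMono.monotone.map_max,
    EReal.toReal_coe]

lemma boundedInProb_eval {Ω : ℕ → Type*} [∀ n, MeasurableSpace (Ω n)] {μ : ∀ n, Measure (Ω n)}
    [∀ n, IsFiniteMeasure (μ n)] {ι : Type*} [Fintype ι] {X : ∀ n, Ω n → ι → ℝ}
    (hX : BoundedInProb μ X) (k : ι) : BoundedInProb μ fun n ω => X n ω k := by
  intro ε hε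
  obtain ⟨M, hM⟩ := hX ε hε
  refine ⟨M, hM.mono fun n hn => (measureReal_mono fun ω hω => ?_).trans hn⟩
  exact lt_of_lt_of_le hω (norm_le_pi_norm (X n ω) k)

lemma sampleMean_eq_add {n m : ℕ} (hn : 0 < n) (x : Sample n m) (k : Fin m) (c : ℝ) :
    sampleMean x k = c + (n : ℝ)⁻¹ * ∑ i, (x i k - c) := by
  simp only [sampleMean, Finset.sum_sub_distrib, Finset.sum_const, Finset.card_univ,
    Fintype.card_fin, nsmul_eq_mul]
  field_simp
  ring

lemma tendsto_rpow_quarter_mul_inv_sqrt {R : ℕ → ℕ}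
    (hRn : Tendsto (fun n : ℕ => √(R n) / (n : ℝ)) atTop (𝓝 0)) :
    Tendsto (fun n : ℕ => (R n : ℝ) ^ (1 / 4 : ℝ) * (√n)⁻¹) atTop (𝓝 0) := by
  have sqrt_tendsto := hRn.sqrt
  rw [Real.sqrt_zero] at sqrt_tendsto
  refine sqrt_tendsto.congr fun n => ?_
  rw [Real.sqrt_div (Real.sqrt_nonneg _), sqrt_eq_rpow_quarter_sq, Real.sqrt_sq (by positivity),
    div_eq_mul_inv]

lemma tendsto_probFilter_scaledMean {m : ℕ} {R : ℕ → ℕ} {P : ∀ n, DGP n m} {k : Fin m} {d : EReal}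
    (hP : BoundedInProb (fun n => (P n).law)
      fun n (x : Sample n m) => (√n)⁻¹ * ∑ i, (x i k - (P n).mean k))
    (hRn : Tendsto (fun n : ℕ => √(R n) / (n : ℝ)) atTop (𝓝 0))
    (hmean : Tendsto (fun n => (((R n : ℝ) ^ (1 / 4 : ℝ) * (P n).mean k : ℝ) : EReal)) atTop
      (𝓝 d)) :
    Tendsto (fun p : Σ n, Sample n m =>
        (((R p.1 : ℝ) ^ (1 / 4 : ℝ) * sampleMean p.2 k : ℝ) : EReal))
      (probFilter fun n => (P n).law) (𝓝 d) := by
  have size_tendsto := tendsto_fst_probFilter (μ := fun n => (P n).law)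
  refine (tendsto_coe_add_zero (hmean.comp size_tendsto) (tendsto_probFilter_mul_of_boundedInProb
    (tendsto_rpow_quarter_mul_inv_sqrt hRn) hP)).congr' ?_
  filter_upwards [size_tendsto.eventually_gt_atTop 0] with p hp
  have inv_sqrt_mul_self : (√(p.1 : ℝ))⁻¹ * (√(p.1 : ℝ))⁻¹ = (p.1 : ℝ)⁻¹ := by
    rw [← mul_inv, Real.mul_self_sqrt (Nat.cast_nonneg _)]
  rw [sampleMean_eq_add hp p.2 k ((P p.1).mean k), ← inv_sqrt_mul_self]
  congr 1
  ring

end ScaledMean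

section RejectionProbability

variable {m : ℕ} {R : ℕ → ℕ} {S : Matrix (Fin m) (Fin m) ℝ} {d : Fin m → EReal} {δ L U α : ℝ}
  {P : ∀ n, DGP n m}

lemma tendsto_rejectionProb (hP : RegularSequence δ L U P)
    (hvar : ∀ k l, ConvergesInProb (fun n => (P n).law) (fun _ x => sampleVar x k l) (S k l))
    (hR : Tendsto R atTop atTop) (hRn : Tendsto (fun n : ℕ => √(R n) / (n : ℝ)) atTop (𝓝 0))
    (hmean : ∀ k, Tendsto (fun n => (((R n : ℝ) ^ (1 / 4 : ℝ) * (P n).mean k : ℝ) : EReal))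
      atTop (𝓝 (d k)))
    (hα0 : 0 < α) (hα1 : α < 1) {β : ℝ} (hβ : β ∈ Set.Icc (0 : ℝ) 1)
    (hcond : ∀ (M : ℝ) (N : ℕ → ℕ) (x : ∀ j, Sample (N j) m),
      RegularArray δ M S N (fun j => R (N j)) x →
      (∀ k, Tendsto (fun j => (((R (N j) : ℝ) ^ (1 / 4 : ℝ) * sampleMean (x j) k : ℝ) : EReal))
        atTop (𝓝 (d k))) →
      Tendsto (fun j => condRejection (R (N j)) α (x j)) atTop (𝓝 β)) :
    Tendsto (fun n => rejectionProb (P n) (R n) α) atTop (𝓝 β) := by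
  have probFilter_le : probFilter (fun n => (P n).law) ≤ sampleFilter R S d :=
    tendsto_id'.1 (tendsto_sampleFilter_iff.2 ⟨tendsto_fst_probFilter,
      fun k l => (tendsto_probFilter_iff_convergesInProb
        (X := fun _ x => sampleVar x k l)).2 (hvar k l),
      fun k => tendsto_probFilter_scaledMean (boundedInProb_eval hP.rootN k) hRn (hmean k)⟩)
  simp only [rejectionProb_eq hα0 hα1]
  refine tendsto_integral_of_tendsto_probFilter (fun n => measurable_condRejection hα0 hα1)
    (fun n x => ⟨measureReal_nonneg, measureReal_le_one⟩) hβ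
    (tendsto_probFilter_of_boundedInProb hP.moment fun M =>
      Tendsto.mono_left (tendsto_of_seq_tendsto fun u hu => ?_)
        (inf_le_inf_right _ probFilter_le))
  obtain ⟨sample_tendsto, moment_le⟩ := tendsto_inf.1 hu
  obtain ⟨size, var, mean⟩ := tendsto_sampleFilter_iff.1 sample_tendsto
  exact hcond M (fun j => (u j).1) (fun j => (u j).2)
    { size, var
      draws := hR.comp size
      sqrt_draws_div_size := hRn.comp size
      moment := (tendsto_principal.1 moment_le).mono fun j hj => (le_abs_self _).trans hj } mean

lemma tendsto_rejectionProb_of_ne_top [NeZero m] (hP : RegularSequence δ L U P) (hδ : 0 < δ)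
    (hvar : ∀ k l, ConvergesInProb (fun n => (P n).law) (fun _ x => sampleVar x k l) (S k l))
    (hS : S.PosDef) (hR : Tendsto R atTop atTop)
    (hRn : Tendsto (fun n : ℕ => √(R n) / (n : ℝ)) atTop (𝓝 0))
    (hmean : ∀ k, Tendsto (fun n => (((R n : ℝ) ^ (1 / 4 : ℝ) * (P n).mean k : ℝ) : EReal))
      atTop (𝓝 (d k)))
    (hα0 : 0 < α) (hα1 : α < 1) {q : ℝ}
    (hq : jointCdf (limitLaw S : Measure (EuclideanSpace ℝ (Fin m))) (fun _ => q) = 1 - α)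
    (hd : ∀ k, d k ≠ ⊤) :
    Tendsto (fun n => rejectionProb (P n) (R n) α) atTop
      (𝓝 (1 - jointCdf (limitLaw S : Measure (EuclideanSpace ℝ (Fin m)))
        fun k => q - limitShift S (fun k => (max (d k) 0).toReal) k)) :=
  tendsto_rejectionProb hP hvar hR hRn hmean hα0 hα1
    ⟨sub_nonneg.2 measureReal_le_one, sub_le_self _ measureReal_nonneg⟩
    fun _ _ _ hx mean => hx.tendsto_condRejection hδ hS hα0 hα1 hq
      fun k => tendsto_max_toReal (mean k) (hd k)

lemma tendsto_rejectionProb_one [NeZero m] (hP : RegularSequence δ L U P) (hδ : 0 < δ)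
    (hvar : ∀ k l, ConvergesInProb (fun n => (P n).law) (fun _ x => sampleVar x k l) (S k l))
    (hS : S.PosDef) (hR : Tendsto R atTop atTop)
    (hRn : Tendsto (fun n : ℕ => √(R n) / (n : ℝ)) atTop (𝓝 0))
    (hmean : ∀ k, Tendsto (fun n => (((R n : ℝ) ^ (1 / 4 : ℝ) * (P n).mean k : ℝ) : EReal))
      atTop (𝓝 (d k)))
    (hα0 : 0 < α) (hα1 : α < 1) {k : Fin m} (hk : d k = ⊤) :
    Tendsto (fun n => rejectionProb (P n) (R n) α) atTop (𝓝 1) :=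
  tendsto_rejectionProb hP hvar hR hRn hmean hα0 hα1 ⟨zero_le_one, le_rfl⟩
    fun _ _ _ hx mean => hx.tendsto_condRejection_one hδ hS hα0 hα1 (k := k)
      (tendsto_atTop_mono (fun _ => le_max_left _ _)
        (EReal.tendsto_coe_nhds_top_iff.1 (hk ▸ mean k)))

lemma jointCdf_sub_limitShift_lt (hS : S.PosDef) (q : ℝ) {y : Fin m → ℝ} {k : Fin m}
    (hk : y k ≠ 0) :
    jointCdf (limitLaw S : Measure (EuclideanSpace ℝ (Fin m))) (fun l => q - limitShift S y l)
      < jointCdf (limitLaw S : Measure (EuclideanSpace ℝ (Fin m))) fun _ => q := by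
  have : NeZero m := ⟨(Fin.pos k).ne'⟩
  have := isOpenPosMeasure_limitLaw hS
  have inv_diag_pos (l : Fin m) : 0 < (S l l)⁻¹ := inv_pos.2 hS.diag_pos
  have inv_sqrt_pos : 0 < (√m)⁻¹ := inv_pos.2 (Real.sqrt_pos.2 (Nat.cast_pos.2 (Fin.pos k)))
  have limitShift_nonneg (l : Fin m) : 0 ≤ limitShift S y l :=
    mul_nonneg (inv_diag_pos l).le (mul_nonneg inv_sqrt_pos.le (sq_nonneg _))
  have limitShift_pos : 0 < limitShift S y k :=
    mul_pos (inv_diag_pos k) (mul_pos inv_sqrt_pos (sq_pos_of_ne_zero hk))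
  exact strictMono_jointCdf (Pi.lt_def.2
    ⟨fun l => sub_le_self _ (limitShift_nonneg l), k, sub_lt_self _ limitShift_pos⟩)

end RejectionProbability

end ResampledTest

end

theorem lemma1 {m : ℕ} (hm : 0 < m) (α : ℝ) (hα₀ : 0 < α) (hα₁ : α < 1)
    (R : ℕ → ℕ) (hR₂ : ∀ n, 2 ≤ R n) (hR : Tendsto R atTop atTop)
    (hRn : Tendsto (fun n : ℕ => Real.sqrt (R n) / (n : ℝ)) atTop (𝓝 0))
    (𝒟₀ : ∀ n, Set (DGP n m)) (h𝒟₀ : RegularClass 𝒟₀)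
    (P : ∀ n, DGP n m) (hP : ∀ n, P n ∈ 𝒟₀ n)
    (δstar : Fin m → EReal)
    (hδ : ∀ k, Tendsto (fun n => (((R n : ℝ) ^ (1 / 4 : ℝ) * (P n).mean k : ℝ) : EReal))
      atTop (𝓝 (δstar k))) :
    ((⨆ k, δstar k) ≤ 0 →
      Tendsto (fun n => rejectionProb (P n) (R n) α) atTop (𝓝 α)) ∧
    ((⨆ k, δstar k) = ⊤ →
      Tendsto (fun n => rejectionProb (P n) (R n) α) atTop (𝓝 1)) ∧
    (0 < (⨆ k, δstar k) ∧ (⨆ k, δstar k) < ⊤ →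
      ∃ β : ℝ, α < β ∧ Tendsto (fun n => rejectionProb (P n) (R n) α) atTop (𝓝 β)) := by
  have : NeZero m := ⟨hm.ne'⟩
  obtain ⟨δ, L, U, hδ₀, hL, -, hclass⟩ := h𝒟₀
  have hseq := hclass P hP
  obtain ⟨S, hvar, -, hSherm, hSeig⟩ := hseq.variance
  have hS : S.PosDef := hSherm.posDef_iff_eigenvalues_pos.2 fun k => hL.trans (hSeig k)
  obtain ⟨q, hq⟩ := exists_jointCdf_const_eq (p := 1 - α) (limitLaw_eval_eq hS)
    (by linarith) (by linarith)
  have tendsto_of_lt_top (htop : (⨆ k, δstar k) < ⊤) :=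
    tendsto_rejectionProb_of_ne_top hseq hδ₀ hvar hS hR hRn hδ hα₀ hα₁ hq
      fun k => ((le_iSup δstar k).trans_lt htop).ne
  refine ⟨fun hle => ?_, fun htop => ?_, fun ⟨hpos, htop⟩ => ⟨_, ?_, tendsto_of_lt_top htop⟩⟩
  · have limit := tendsto_of_lt_top (hle.trans_lt EReal.zero_lt_top)
    simpa [limitShift, max_eq_right ((le_iSup δstar _).trans hle), hq] using limit
  · obtain ⟨k, hk⟩ := exists_eq_ciSup_of_finite (f := δstar)
    exact tendsto_rejectionProb_one hseq hδ₀ hvar hS hR hRn hδ hα₀ hα₁ (hk.trans htop)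
  · obtain ⟨k, hk⟩ := lt_iSup_iff.1 hpos
    have toReal_pos : 0 < (max (δstar k) 0).toReal := by
      rw [max_eq_left hk.le]
      exact EReal.toReal_pos hk ((le_iSup δstar k).trans_lt htop).ne
    have := jointCdf_sub_limitShift_lt hS q (y := fun k => (max (δstar k) 0).toReal)
      toReal_pos.ne'
    linarith
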